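/- Let $d\ge 0$, $n=d+1$, $m\ge 0$ be integers, write $y=(y',y_n)\in\mathbb R^{n-1}\times\mathbb R$ and, for $\mathbf v=(v^1,\dots,v^m)$, $\nabla\mathbf v=(\partial_k v^i)_{1\le i\le m,\,1\le k\le n}\in\mathbb R^{m\times n}$. Consider the nonlinear degenerate system $$y_n\,\partial_n^2 v^j+\gamma_j\,\partial_n v^j \;=\; y_n\sum_{k,\ell=1}^n A^j_{k\ell}(\nabla \mathbf v)\,\partial_{k\ell}v^j+g^j(\mathbf v,\nabla\mathbf v),\qquad j=1,\dots,m, \tag{1}$$ where $\gamma_j>1$, the functions $A^j_{k\ell}$ (of $p=(p^i_k)\in\mathbb R^{m\times n}$) and $g^j$ (of $(s,p)\in\mathbb R^m\times\mathbb R^{m\times n}$) are real analytic near the origin, and $$A^j_{nn}(0)=0,\qquad g^j(0,0)=0,\qquad \frac{\partial g^j}{\partial p^i_n}(0,0)=0\qquad (1\le i,j\le m).$$ Then there is $\delta_0>0$ such that for every $\delta\in(0,\delta_0]$ there is $\varepsilon_0>0$ (depending only on the system and on $\delta$) with the following property. If $\mathbf v_0:\mathbb R^{n-1}\to\mathbb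 R^m$ is real analytic near $0$ with $$|\mathbf v_0(0)|\le\varepsilon_0,\qquad |\nabla'\mathbf v_0(0)|\le\varepsilon_0,$$ where $\nabla'$ is the gradient in $y'$, then there is a function $\mathbf v$, real analytic in a neighbourhood of $0\in\mathbb R^n$, which satisfies (1) in a neighbourhood of $0$, $\mathbf v(y',0)=\mathbf v_0(y')$ for $y'$ near $0$, and $|\partial_n\mathbf v(0)|\le\delta$. It is the unique analytic local solution with small normal derivative at $0$: if $\mathbf w$ is real analytic in a neighbourhood of $0$, satisfies (1) at all points of some neighbourhood of $0$ with $y_n>0$, $\mathbf w(y',0)=\mathbf v_0(y')$ for $y'$ near $0$, and $|\partial_n\mathbf w(0)|\le\delta_0$, then $\mathbf w=\mathbf v$ in a neighbourhood of $0$. -/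

import Mathlib

open Filter Topology

namespace DegenerateSystem

/-- The coordinate partial derivative `∂_k u` of a scalar function on `ℝⁿ`. -/
noncomputable def partialDeriv {n : ℕ} (k : Fin n) (u : EuclideanSpace ℝ (Fin n) → ℝ) :
    EuclideanSpace ℝ (Fin n) → ℝ :=
  fun y => fderiv ℝ u y (EuclideanSpace.single k 1)

/-- The full gradient `∇v(y) = (∂_k vⁱ(y))_{i,k}` of a vector valued function. -/
noncomputable def jacobian {n m : ℕ}
    (v : EuclideanSpace ℝ (Fin n) → EuclideanSpace ℝ (Fin m)) (y : EuclideanSpace ℝ (Fin n)) :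
    Fin m → Fin n → ℝ :=
  fun i k => partialDeriv k (fun z => v z i) y

/-- The vector `∂_n v(y) = (∂_n v¹(y), …, ∂_n vᵐ(y))`, where `n = d + 1` and `y_n` is the last
coordinate. -/
noncomputable def normalDeriv {d m : ℕ}
    (v : EuclideanSpace ℝ (Fin (d + 1)) → EuclideanSpace ℝ (Fin m))
    (y : EuclideanSpace ℝ (Fin (d + 1))) : EuclideanSpace ℝ (Fin m) :=
  WithLp.toLp 2 (fun i => jacobian v y i (Fin.last d))

/-- The boundary point `(y', 0)`. -/
def boundaryPoint {d : ℕ} (y' : EuclideanSpace ℝ (Fin d)) : EuclideanSpace ℝ (Fin (d + 1)) :=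
  WithLp.toLp 2 (Fin.snoc (α := fun _ => ℝ) (fun i => y' i) 0)

/-- The system holds at the point `y`: for every `j`,
`y_n ∂_n² vʲ + γ_j ∂_n vʲ = y_n ∑_{k,ℓ} Aʲ_{kℓ}(∇v) ∂_{kℓ} vʲ + gʲ(v, ∇v)`. -/
def SystemAt {d m : ℕ} (γ : Fin m → ℝ)
    (A : Fin m → Fin (d + 1) → Fin (d + 1) → (Fin m → Fin (d + 1) → ℝ) → ℝ)
    (g : Fin m → EuclideanSpace ℝ (Fin m) × (Fin m → Fin (d + 1) → ℝ) → ℝ)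
    (v : EuclideanSpace ℝ (Fin (d + 1)) → EuclideanSpace ℝ (Fin m))
    (y : EuclideanSpace ℝ (Fin (d + 1))) : Prop :=
  ∀ j : Fin m,
    y (Fin.last d) *
          partialDeriv (Fin.last d) (partialDeriv (Fin.last d) (fun z => v z j)) y
        + γ j * partialDeriv (Fin.last d) (fun z => v z j) y
      = y (Fin.last d) *
          (∑ k, ∑ l, A j k l (jacobian v y) * partialDeriv k (partialDeriv l (fun z => v z j)) y)
        + g j (v y, jacobian v y)

end DegenerateSystem

/-!
The theorem is proved by a contraction argument in a Banach algebra of power series, after a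
rescaling that makes all data small.

*Reduction.* Write `t = yₙ`. On `t = 0` the system degenerates to the boundary equation `γⱼ qⱼ =
gʲ(s, p', q)` for the normal derivative `q`. As `γⱼ ≠ 0` and `∂g/∂q` vanishes at the origin, the
analytic inverse function theorem (`exists_boundaryMap_inverse`) determines `q` from `v₀`, uniquely
among small values. Let `b(y) = v₀(y') + t q(y')` be the resulting `background`. Any analytic `v`
with the `1`-jet of `b` on `t = 0` has, for small `r`, the form `v(ry) = b(ry) + r I²U(y)`, where `I
= ∂ₜ⁻¹` is integration from `t = 0` (`eventually_eq_add_ev_intL_intL`).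

*Equation for `U`.* In terms of `U`, the residual of the system is `t` times `U + γⱼ H U - ∑ A(∇v)
∂²v - H X`, where `H` is the mean value operator `tᵏ ↦ tᵏ / (k + 1)` and `X` is the `t`-derivative
of `gʲ(v, ∇v)`. The Fuchsian operator `1 + γ H` has an inverse of norm at most one (`fuchsInv`), so
the system is equivalent to a fixed-point equation `U = T(θ, U)`, with the rescaled data and `r`
collected in a parameter `θ` (`FuchsData.map`).

*The algebra.* Power series are normed by the weighted `ℓ¹` norm with weight `τ^{αₙ} α! / |α|!` on
`y^α` (`multiWeight`). The weight is submultiplicative, so this is a Banach algebra, and analytic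
functions act on it by a functional calculus (`AnalyticAt.exists_functional_calculus`). The
factorials make `∂ₖ ∂ₜ⁻¹` bounded, with norm at most `τ` for `k ≠ n` (`WAlg.derivInt`). The
contribution of `U` to the second derivatives of `v` is therefore bounded by `U`, with a factor `τ`
for all but `∂ₙ²`; the coefficient `A_{nn}` of `∂ₙ²` vanishes at `0`, and so does the coefficient
`∂g/∂pₙ` in `X`. Hence `T` is strictly differentiable at `0` with partial derivative in `U` of norm
`O(τ) < 1` (`FuchsData.exists_hasStrictFDerivAt_map`).

*Conclusion.* Near `0` the fixed-point equation has a solution for every small parameter and at most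
one small solution. As `r → 0`, the parameter `θ` tends to the `1`-jet of `b` at `0`, which is small
by assumption, and the `U` belonging to any analytic solution tends to `0`, so existence and
uniqueness follow together (`exists_unique_of_boundary_jet`). For uniqueness the system is only
needed on `t > 0`: by continuity it forces the boundary equation on `t = 0`
(`eventually_eq_zero_of_normal_pos`), and an element of the algebra which vanishes on an open set is
zero (`eq_zero_of_ev_normal_pos`).
-/

/-! ### Weighted `ℓ¹` convolution algebras -/

/-- A positive submultiplicative weight on an additive commutative monoid. -/
structure MonoidWeight (I : Type*) [AddCommMonoid I] where
  /-- the weight function -/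
  val : I → ℝ
  pos : ∀ i, 0 < val i
  zero : val 0 = 1
  add_le : ∀ i j, val (i + j) ≤ val i * val j

/-- The weighted convolution algebra `ℓ¹(I, w)`. An element is encoded by its *normalised*
coefficients, so that the underlying Banach space is the unweighted `ℓ¹(I)`: the formal sum
`∑ cᵢ Xⁱ` corresponds to the sequence `wᵢ cᵢ`. -/
def WAlg {I : Type*} [AddCommMonoid I] (_w : MonoidWeight I) : Type _ := lp (fun _ : I => ℝ) 1

namespace WAlg

variable {I : Type*} [AddCommMonoid I] {w : MonoidWeight I}

noncomputable instance : NormedAddCommGroup (WAlg w) :=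
  inferInstanceAs (NormedAddCommGroup (lp (fun _ : I => ℝ) 1))

noncomputable instance : NormedSpace ℝ (WAlg w) :=
  inferInstanceAs (NormedSpace ℝ (lp (fun _ : I => ℝ) 1))

instance : CompleteSpace (WAlg w) :=
  inferInstanceAs (CompleteSpace (lp (fun _ : I => ℝ) 1))

/-- The coefficient of `Xⁱ`. -/
noncomputable def coeff (a : WAlg w) (i : I) : ℝ :=
  (show lp (fun _ : I => ℝ) 1 from a) i / w.val i

open Classical in
/-- The monomial `Xⁱ`. -/
noncomputable def mono (w : MonoidWeight I) (i : I) : WAlg w :=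
  show lp (fun _ : I => ℝ) 1 from lp.single 1 i (w.val i)

theorem coeff_add (a b : WAlg w) (i : I) : coeff (a + b) i = coeff a i + coeff b i :=
  add_div _ _ _

theorem coeff_smul (c : ℝ) (a : WAlg w) (i : I) : coeff (c • a) i = c * coeff a i :=
  mul_div_assoc _ _ _

theorem norm_mono (i : I) : ‖mono w i‖ = w.val i := by
  classical
  have h := lp.norm_single (E := fun _ : I => ℝ) (p := 1) (by norm_num) i (w.val i)
  rw [Real.norm_of_nonneg (w.pos i).le] at h
  exact h

theorem hasSum_norm (a : WAlg w) : HasSum (fun i => w.val i * |coeff a i|) ‖a‖ := by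
  have h := lp.hasSum_norm (p := 1) (E := fun _ : I => ℝ) (by norm_num) a
  simp only [ENNReal.toReal_one, Real.rpow_one] at h
  have e : (fun i => w.val i * |coeff a i|)
      = fun i => ‖(show lp (fun _ : I => ℝ) 1 from a) i‖ := by
    funext i
    rw [coeff, abs_div, abs_of_pos (w.pos i), mul_div_cancel₀ _ (w.pos i).ne']
    rfl
  rw [e]
  exact h

theorem hasSum_mono (a : WAlg w) : HasSum (fun i => coeff a i • mono w i) a := by
  classical
  have h := lp.hasSum_single (p := 1) (E := fun _ : I => ℝ) (by norm_num) a
  have e : (fun i => (lp.single 1 i ((show lp (fun _ : I => ℝ) 1 from a) i) :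
      lp (fun _ : I => ℝ) 1)) = fun i => coeff a i • mono w i := by
    funext i
    have : (lp.single 1 i (coeff a i • w.val i) : lp (fun _ : I => ℝ) 1)
        = coeff a i • lp.single 1 i (w.val i) := lp.single_smul ..
    rw [coeff, smul_eq_mul, div_mul_cancel₀ _ (w.pos i).ne'] at this
    exact this
  rw [← e]
  exact h

theorem coeff_mono_self (i : I) : coeff (mono w i) i = 1 := by
  classical
  have := lp.single_apply_self (E := fun _ : I => ℝ) 1 i (w.val i)
  unfold coeff mono
  rw [div_eq_one_iff_eq (w.pos i).ne']
  convert this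

theorem coeff_mono_ne {i j : I} (h : j ≠ i) : coeff (mono w i) j = 0 := by
  classical
  have := lp.single_apply_ne (E := fun _ : I => ℝ) 1 i (w.val i) h
  unfold coeff mono
  rw [div_eq_zero_iff]
  left
  convert this

theorem eq_zero_of_coeff {a : WAlg w} (h : ∀ i, coeff a i = 0) : a = 0 := by
  have := hasSum_mono a
  simp only [h, zero_smul] at this
  exact this.unique hasSum_zero

/-- Two continuous linear maps which agree on monomials are equal. -/
theorem clm_ext {V : Type*} [NormedAddCommGroup V] [NormedSpace ℝ V] {S T : WAlg w →L[ℝ] V}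
    (h : ∀ i, S (mono w i) = T (mono w i)) : S = T := by
  ext a
  have h1 := (hasSum_mono a).mapL S
  have h2 := (hasSum_mono a).mapL T
  simp only [map_smul, h] at h1 h2
  exact h1.unique h2

section Lift

variable {V : Type*} [NormedAddCommGroup V] [NormedSpace ℝ V]

theorem norm_coeff_smul_le {f : I → V} {C : ℝ} (hf : ∀ i, ‖f i‖ ≤ C * w.val i) (a : WAlg w)
    (i : I) : ‖coeff a i • f i‖ ≤ C * (w.val i * |coeff a i|) := by
  rw [norm_smul, Real.norm_eq_abs]
  calc |coeff a i| * ‖f i‖ ≤ |coeff a i| * (C * w.val i) := by gcongr; exact hf i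
    _ = _ := by ring

variable [CompleteSpace V]

theorem summable_lift {f : I → V} {C : ℝ} (hf : ∀ i, ‖f i‖ ≤ C * w.val i) (a : WAlg w) :
    Summable fun i => coeff a i • f i :=
  .of_norm_bounded ((hasSum_norm a).mul_left C).summable (norm_coeff_smul_le hf a)

/-- The universal property of `ℓ¹(I, w)`: a family `f` with `‖f i‖ ≤ C w i` extends uniquely to a
continuous linear map sending `Xⁱ` to `f i`. -/
noncomputable def lift (f : I → V) (C : ℝ) (hf : ∀ i, ‖f i‖ ≤ C * w.val i) : WAlg w →L[ℝ] V :=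
  LinearMap.mkContinuous
    { toFun := fun a => ∑' i, coeff a i • f i
      map_add' := fun a b => by
        simp only [coeff_add, add_smul]
        exact (summable_lift hf a).tsum_add (summable_lift hf b)
      map_smul' := fun c a => by
        simp only [coeff_smul, mul_smul, RingHom.id_apply]
        exact (summable_lift hf a).tsum_const_smul c } C
    fun a => tsum_of_norm_bounded ((hasSum_norm a).mul_left C) (norm_coeff_smul_le hf a)

theorem lift_mono (f : I → V) (C : ℝ) (hf : ∀ i, ‖f i‖ ≤ C * w.val i) (i : I) :
    lift f C hf (mono w i) = f i := by
  change ∑' j, coeff (mono w i) j • f j = f i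
  rw [tsum_eq_single i, coeff_mono_self, one_smul]
  intro j hj
  rw [coeff_mono_ne hj, zero_smul]

theorem norm_lift_le (f : I → V) {C : ℝ} (hC : 0 ≤ C) (hf : ∀ i, ‖f i‖ ≤ C * w.val i) :
    ‖lift f C hf‖ ≤ C := LinearMap.mkContinuous_norm_le _ hC _

theorem norm_clm_le {T : WAlg w →L[ℝ] V} {C : ℝ} (hC : 0 ≤ C)
    (hT : ∀ i, ‖T (mono w i)‖ ≤ C * w.val i) : ‖T‖ ≤ C := by
  have : T = lift (fun i => T (mono w i)) C hT := clm_ext fun i => by rw [lift_mono]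
  rw [this]
  exact norm_lift_le _ hC _

end Lift

/-- Multiplication by the monomial `Xⁱ`. -/
noncomputable def mulMono (w : MonoidWeight I) (i : I) : WAlg w →L[ℝ] WAlg w :=
  lift (fun j => mono w (i + j)) (w.val i) fun j => by rw [norm_mono]; exact w.add_le i j

theorem norm_mulMono (i : I) : ‖mulMono w i‖ ≤ 1 * w.val i := by
  rw [one_mul]; exact norm_lift_le _ (w.pos i).le _

/-- Convolution as a continuous bilinear map. -/
noncomputable def mulL (w : MonoidWeight I) : WAlg w →L[ℝ] WAlg w →L[ℝ] WAlg w :=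
  lift (mulMono w) 1 norm_mulMono

theorem mulL_mono (i j : I) : mulL w (mono w i) (mono w j) = mono w (i + j) := by
  rw [mulL, lift_mono, mulMono, lift_mono]

theorem norm_mulL : ‖mulL w‖ ≤ 1 := norm_lift_le _ zero_le_one _

theorem mulL_comm (a b : WAlg w) : mulL w a b = mulL w b a := by
  have : mulL w = (mulL w).flip := clm_ext fun i => clm_ext fun j => by
    rw [ContinuousLinearMap.flip_apply, mulL_mono, mulL_mono, add_comm]
  conv_lhs => rw [this]
  rfl

theorem mulL_one (a : WAlg w) : mulL w (mono w 0) a = a := by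
  have : mulL w (mono w 0) = ContinuousLinearMap.id ℝ _ := clm_ext fun i => by
    rw [mulL_mono, zero_add]; rfl
  rw [this]; rfl

theorem mulL_assoc (a b c : WAlg w) : mulL w (mulL w a b) c = mulL w a (mulL w b c) := by
  have h1 : ∀ i j, mulL w (mulL w (mono w i) (mono w j)) =
      (mulL w (mono w i)).comp (mulL w (mono w j)) := fun i j => clm_ext fun k => by
    simp only [ContinuousLinearMap.comp_apply, mulL_mono, add_assoc]
  have h2 : ∀ i c, (mulL w).flip c ∘L mulL w (mono w i) =
      (mulL w (mono w i)).comp ((mulL w).flip c) := fun i c => clm_ext fun j => by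
    simpa using DFunLike.congr_fun (h1 i j) c
  have h3 : ((mulL w).flip c).comp ((mulL w).flip b) = (mulL w).flip (mulL w b c) :=
    clm_ext fun i => by simpa using DFunLike.congr_fun (h2 i c) b
  simpa using DFunLike.congr_fun h3 a

noncomputable instance : NormedCommRing (WAlg w) where
  mul a b := mulL w a b
  one := mono w 0
  left_distrib a b c := (mulL w a).map_add b c
  right_distrib a b c := by
    change mulL w (a + b) c = mulL w a c + mulL w b c
    rw [map_add]; rfl
  zero_mul a := by change mulL w 0 a = 0; rw [map_zero]; rfl
  mul_zero a := (mulL w a).map_zero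
  mul_assoc := mulL_assoc
  one_mul := mulL_one
  mul_one a := (mulL_comm _ _).trans (mulL_one a)
  mul_comm := mulL_comm
  dist_eq := NormedAddCommGroup.dist_eq
  norm_mul_le a b := by
    refine ((mulL w).le_opNorm₂ a b).trans ?_
    have := norm_mulL (w := w)
    nlinarith [norm_nonneg a, norm_nonneg b, mul_nonneg (norm_nonneg a) (norm_nonneg b)]

theorem mul_eq_mulL (a b : WAlg w) : a * b = mulL w a b := rfl

theorem one_eq_mono : (1 : WAlg w) = mono w 0 := rfl

noncomputable instance : NormedAlgebra ℝ (WAlg w) where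
  __ := Algebra.ofModule (R := ℝ) (A := WAlg w)
    (fun r x y => by rw [mul_eq_mulL, mul_eq_mulL, map_smul]; rfl)
    (fun r x y => by rw [mul_eq_mulL, mul_eq_mulL, map_smul])
  norm_smul_le := norm_smul_le

instance : NormOneClass (WAlg w) := ⟨by rw [one_eq_mono, norm_mono, w.zero]⟩

end WAlg

/-! ### Analytic functional calculus in a commutative Banach algebra -/

section FunctionalCalculus

variable {ι : Type*} [Fintype ι] [DecidableEq ι] {B : Type*} [NormedCommRing B] [NormedAlgebra ℝ B]

/-- The extension of an `N`-linear form on `ℝ^ι` to an `N`-linear map on `B^ι`: the monomials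
`∏ xᵢ` are replaced by products in `B`. -/
noncomputable def multilinearExtend (B : Type*) [NormedCommRing B] [NormedAlgebra ℝ B] (N : ℕ)
    (p : (ι → ℝ) [×N]→L[ℝ] ℝ) : (ι → B) [×N]→L[ℝ] B :=
  ∑ w : Fin N → ι, p (fun i => Pi.single (w i) 1) •
    (ContinuousMultilinearMap.mkPiAlgebraFin ℝ N B).compContinuousLinearMap
      fun i => ContinuousLinearMap.proj (w i)

theorem norm_multilinearExtend_le [NormOneClass B] (N : ℕ) (p : (ι → ℝ) [×N]→L[ℝ] ℝ) :
    ‖multilinearExtend B N p‖ ≤ (Fintype.card ι : ℝ) ^ N * ‖p‖ := by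
  have h : ∀ w : Fin N → ι, ‖p (fun i => Pi.single (w i) 1) •
      (ContinuousMultilinearMap.mkPiAlgebraFin ℝ N B).compContinuousLinearMap
        fun i => (ContinuousLinearMap.proj (w i) : (ι → B) →L[ℝ] B)‖ ≤ ‖p‖ := by
    intro w
    rw [norm_smul]
    have h1 : ‖p (fun i => Pi.single (w i) 1)‖ ≤ ‖p‖ := by
      refine (p.le_opNorm _).trans (mul_le_of_le_one_right (norm_nonneg _) ?_)
      refine Finset.prod_le_one (fun i _ => norm_nonneg _) fun i _ => ?_
      rw [Pi.norm_single]; simp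
    have h2 : ‖(ContinuousMultilinearMap.mkPiAlgebraFin ℝ N B).compContinuousLinearMap
        fun i => (ContinuousLinearMap.proj (w i) : (ι → B) →L[ℝ] B)‖ ≤ 1 := by
      refine (ContinuousMultilinearMap.norm_compContinuousLinearMap_le _ _).trans ?_
      rw [ContinuousMultilinearMap.norm_mkPiAlgebraFin, one_mul]
      refine Finset.prod_le_one (fun i _ => norm_nonneg _) fun i _ => ?_
      refine ContinuousLinearMap.opNorm_le_bound _ zero_le_one fun x => ?_
      rw [one_mul]
      exact norm_le_pi_norm x (w i)
    calc _ ≤ ‖p‖ * 1 := mul_le_mul h1 h2 (norm_nonneg _) (norm_nonneg _)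
      _ = ‖p‖ := mul_one _
  refine (norm_sum_le_of_le _ fun w _ => h w).trans ?_
  simp

theorem map_multilinearExtend (N : ℕ) (p : (ι → ℝ) [×N]→L[ℝ] ℝ) (χ : B →ₐ[ℝ] ℝ) (a : ι → B) :
    χ (multilinearExtend B N p fun _ => a) = p fun _ i => χ (a i) := by
  have e : (fun _ : Fin N => fun i => χ (a i))
      = fun _ => ∑ i, χ (a i) • (Pi.single i 1 : ι → ℝ) := by
    funext _
    exact pi_eq_sum_univ' fun i => χ (a i)
  rw [e, ContinuousMultilinearMap.map_sum]
  simp only [multilinearExtend, sum_apply,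
    smul_apply, map_sum, map_smul]
  refine Finset.sum_congr rfl fun w _ => ?_
  rw [ContinuousMultilinearMap.map_smul_univ, ContinuousMultilinearMap.compContinuousLinearMap_apply,
    ContinuousMultilinearMap.mkPiAlgebraFin_apply, map_list_prod, List.map_ofFn, List.prod_ofFn,
    smul_eq_mul, smul_eq_mul, mul_comm]
  rfl

/-- **Analytic functional calculus.** A function `f` which is analytic at `0 ∈ ℝ^ι` extends to a
function `F` which is analytic at `0 ∈ B^ι` and is compatible with all characters of norm at most
`1`. -/
theorem AnalyticAt.exists_functional_calculus [NormOneClass B] [CompleteSpace B]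
    {f : (ι → ℝ) → ℝ} (hf : AnalyticAt ℝ f 0) :
    ∃ F : (ι → B) → B, AnalyticAt ℝ F 0 ∧ F 0 = algebraMap ℝ B (f 0) ∧
      ∃ ε : ℝ, 0 < ε ∧ ∀ χ : B →ₐ[ℝ] ℝ, (∀ a, ‖χ a‖ ≤ ‖a‖) → ∀ a : ι → B, ‖a‖ < ε →
        χ (F a) = f fun i => χ (a i) := by
  obtain ⟨p, R, hp⟩ := hf
  obtain ⟨r, hr0, hrp⟩ := ENNReal.lt_iff_exists_nnreal_btwn.1 hp.radius_pos
  rw [ENNReal.coe_pos] at hr0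
  obtain ⟨C, hC, hpC⟩ := p.norm_mul_pow_le_of_lt_radius hrp
  set q : FormalMultilinearSeries ℝ (ι → B) B := fun N => multilinearExtend B N (p N) with hq
  set s : NNReal := r / (Fintype.card ι + 1) with hs
  have hs0 : 0 < s := by positivity
  have hqs : (s : ENNReal) ≤ q.radius := by
    refine q.le_radius_of_bound C fun N => ?_
    have hN : (Fintype.card ι : ℝ) * s ≤ r := by
      rw [hs]
      push_cast
      rw [mul_div_assoc', div_le_iff₀ (by positivity)]
      nlinarith [r.coe_nonneg]
    calc ‖q N‖ * (s : ℝ) ^ N ≤ ((Fintype.card ι : ℝ) ^ N * ‖p N‖) * (s : ℝ) ^ N := by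
          gcongr; exact norm_multilinearExtend_le N (p N)
      _ = ‖p N‖ * ((Fintype.card ι : ℝ) * s) ^ N := by rw [mul_pow]; ring
      _ ≤ ‖p N‖ * (r : ℝ) ^ N := by gcongr
      _ ≤ C := hpC N
  have hq0 : 0 < q.radius := lt_of_lt_of_le (by exact_mod_cast hs0) hqs
  have hF := q.hasFPowerSeriesOnBall hq0
  obtain ⟨t, ht0, htR⟩ := ENNReal.lt_iff_exists_nnreal_btwn.1 hp.r_pos
  rw [ENNReal.coe_pos] at ht0
  refine ⟨q.sum, hF.analyticAt, ?_, min s t, lt_min (by exact_mod_cast hs0) (by exact_mod_cast ht0),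
    fun χ hχ a ha => ?_⟩
  · have h0 := hF.coeff_zero (fun _ => 0)
    rw [← h0, ← hp.coeff_zero (fun _ => 0), hq]
    simp only [multilinearExtend, Finset.univ_unique, Finset.sum_singleton,
      smul_apply, ContinuousMultilinearMap.compContinuousLinearMap_apply,
      ContinuousMultilinearMap.mkPiAlgebraFin_apply, List.ofFn_zero, List.prod_nil,
      Algebra.algebraMap_eq_smul_one]
    congr 2
    exact Subsingleton.elim _ _
  · have hχc : Continuous χ :=
      (LinearMap.mkContinuous χ.toLinearMap 1 fun x => by simpa using hχ x).continuous
    have has : a ∈ Metric.eball (0 : ι → B) q.radius := by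
      rw [Metric.mem_eball, edist_zero_right]
      refine lt_of_lt_of_le ?_ hqs
      rw [← ofReal_norm, ENNReal.ofReal_lt_iff_lt_toReal (norm_nonneg _) (by simp)]
      exact ha.trans_le (min_le_left _ _)
    have h1 := (q.hasSum has).map χ.toAddMonoidHom hχc
    have hb : (fun i => χ (a i)) ∈ Metric.eball (0 : ι → ℝ) R := by
      rw [Metric.mem_eball, edist_zero_right]
      refine lt_trans ?_ htR
      rw [← ofReal_norm, ENNReal.ofReal_lt_iff_lt_toReal (norm_nonneg _) (by simp)]
      refine lt_of_le_of_lt ?_ (ha.trans_le (min_le_right _ _))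
      exact (pi_norm_le_iff_of_nonneg (norm_nonneg _)).2 fun i =>
        (hχ _).trans (norm_le_pi_norm a i)
    have h2 := hp.hasSum hb
    rw [zero_add] at h2
    refine h1.unique ?_
    have e : (χ.toAddMonoidHom ∘ fun N => q N fun _ => a) = fun N => p N fun _ i => χ (a i) :=
      funext fun N => map_multilinearExtend N (p N) χ a
    rw [e]
    exact h2

end FunctionalCalculus

/-! ### The multinomial weight -/

section Multinomial

open Finset

theorem Nat.choose_mul_choose_le (a b c e : ℕ) :
    a.choose b * c.choose e ≤ (a + c).choose (b + e) := by
  rw [Nat.add_choose_eq]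
  exact Finset.single_le_sum (f := fun ij : ℕ × ℕ => a.choose ij.1 * c.choose ij.2)
    (fun _ _ => Nat.zero_le _) (mem_antidiagonal.2 (rfl : (b, e).1 + (b, e).2 = b + e))

variable {σ : Type*} [DecidableEq σ]

/-- Supermultiplicativity of the multinomial coefficients, by iterating Vandermonde's inequality
for binomial coefficients; it makes the weight `α!/|α|!` submultiplicative. -/
theorem Nat.multinomial_mul_le (s : Finset σ) (f g : σ → ℕ) :
    Nat.multinomial s f * Nat.multinomial s g ≤ Nat.multinomial s (f + g) := by
  induction s using Finset.induction_on with
  | empty => simp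
  | insert a s ha ih =>
    rw [Nat.multinomial_insert ha, Nat.multinomial_insert ha, Nat.multinomial_insert ha]
    have h := Nat.choose_mul_choose_le (f a + ∑ i ∈ s, f i) (f a) (g a + ∑ i ∈ s, g i) (g a)
    have e : f a + ∑ i ∈ s, f i + (g a + ∑ i ∈ s, g i)
        = (f + g) a + ∑ i ∈ s, (f + g) i := by
      simp only [Pi.add_apply, Finset.sum_add_distrib]; ring
    rw [e] at h
    calc _ = ((f a + ∑ i ∈ s, f i).choose (f a) * (g a + ∑ i ∈ s, g i).choose (g a)) *
          (Nat.multinomial s f * Nat.multinomial s g) := by ring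
      _ ≤ _ := Nat.mul_le_mul h ih

theorem Nat.multinomial_le_two_pow (s : Finset σ) (f : σ → ℕ) :
    Nat.multinomial s f ≤ (2 ^ s.card) ^ ∑ i ∈ s, f i := by
  induction s using Finset.induction_on with
  | empty => simp
  | insert a s ha ih =>
    rw [Nat.multinomial_insert ha, Finset.sum_insert ha, Finset.card_insert_of_notMem ha, pow_succ,
      mul_pow, mul_comm]
    refine Nat.mul_le_mul (ih.trans ?_) (Nat.choose_le_two_pow _ _)
    exact Nat.pow_le_pow_right (by positivity) (Nat.le_add_left _ _)

/-- The multi-index `eₖ`. -/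
abbrev eIdx (k : σ) : σ → ℕ := Pi.single k 1

theorem Nat.multinomial_add_single [Fintype σ] (α : σ → ℕ) (k : σ) :
    Nat.multinomial univ (α + eIdx k) * (α k + 1)
      = Nat.multinomial univ α * (∑ i, α i + 1) := by
  have h1 := Nat.multinomial_spec univ α
  have h2 := Nat.multinomial_spec univ (α + eIdx k)
  have hs : ∑ i, (α + eIdx k) i = ∑ i, α i + 1 := by
    simp [Finset.sum_add_distrib, Finset.sum_pi_single']
  have hp : ∏ i, ((α + eIdx k) i).factorial = (α k + 1) * ∏ i, (α i).factorial := by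
    rw [← Finset.mul_prod_erase univ _ (mem_univ k),
      ← Finset.mul_prod_erase univ (fun i => (α i).factorial) (mem_univ k), ← mul_assoc]
    congr 1
    · simp [Nat.factorial_succ]
    · refine Finset.prod_congr rfl fun i hi => ?_
      simp [Finset.ne_of_mem_erase hi]
  rw [hs, Nat.factorial_succ, ← h1, hp] at h2
  have hpos : 0 < ∏ i, (α i).factorial := Finset.prod_pos fun i _ => Nat.factorial_pos _
  refine Nat.eq_of_mul_eq_mul_left hpos ?_
  linarith

end Multinomial

section Weight

variable {σ : Type*} [Fintype σ] [DecidableEq σ]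

/-- The weight `τ^{α_o} α!/|α|!` on multi-indices, where `o` is the distinguished ("normal")
coordinate. It makes the operator `∂ₖ ∂ₒ⁻¹`, `k ≠ o`, bounded with norm at most `τ`. -/
noncomputable def multiWeight (o : σ) (τ : ℝ) (hτ : 0 < τ) : MonoidWeight (σ → ℕ) where
  val α := τ ^ α o / Nat.multinomial Finset.univ α
  pos α := div_pos (pow_pos hτ _) (by exact_mod_cast Nat.multinomial_pos _ _)
  zero := by simp [Nat.multinomial]
  add_le α β := by
    have h1 : (0 : ℝ) < Nat.multinomial Finset.univ α := by
      exact_mod_cast Nat.multinomial_pos _ _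
    have h2 : (0 : ℝ) < Nat.multinomial Finset.univ β := by
      exact_mod_cast Nat.multinomial_pos _ _
    rw [div_mul_div_comm, Pi.add_apply, pow_add]
    refine div_le_div_of_nonneg_left (by positivity) (by positivity) ?_
    exact_mod_cast Nat.multinomial_mul_le Finset.univ α β

variable {o : σ} {τ : ℝ} {hτ : 0 < τ}

theorem multiWeight_add_single (α : σ → ℕ) (k : σ) :
    (multiWeight o τ hτ).val (α + eIdx k) * (∑ i, α i + 1 : ℕ)
      = (if k = o then τ else 1) * (α k + 1) * (multiWeight o τ hτ).val α := by
  have h := Nat.multinomial_add_single α k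
  have h1 : (0 : ℝ) < Nat.multinomial Finset.univ α := by
    exact_mod_cast Nat.multinomial_pos _ _
  have h2 : (0 : ℝ) < Nat.multinomial Finset.univ (α + eIdx k) := by
    exact_mod_cast Nat.multinomial_pos _ _
  have h' : (Nat.multinomial Finset.univ (α + eIdx k) : ℝ) * (α k + 1)
      = Nat.multinomial Finset.univ α * (∑ i, α i + 1 : ℕ) := by exact_mod_cast h
  have hp : τ ^ (α + eIdx k) o = (if k = o then τ else 1) * τ ^ α o := by
    by_cases hk : k = o
    · subst hk; simp [pow_succ, mul_comm]
    · simp [hk, Ne.symm hk]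
  simp only [multiWeight]
  rw [hp, div_mul_eq_mul_div, mul_div_assoc', div_eq_div_iff h2.ne' h1.ne']
  linear_combination (-(if k = o then τ else 1) * τ ^ α o) * h'

/-- The radius of a polydisc on which evaluation is a contraction. -/
noncomputable def evalRadius (σ : Type*) [Fintype σ] (τ : ℝ) : ℝ := τ / 2 ^ Fintype.card σ

omit [DecidableEq σ] in
theorem evalRadius_pos (hτ : 0 < τ) : 0 < evalRadius σ τ := by unfold evalRadius; positivity

theorem evalRadius_pow_le (hτ1 : τ ≤ 1) (α : σ → ℕ) :
    evalRadius σ τ ^ ∑ i, α i ≤ (multiWeight o τ hτ).val α := by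
  have h1 : (0 : ℝ) < Nat.multinomial Finset.univ α := by
    exact_mod_cast Nat.multinomial_pos _ _
  have h2 : (Nat.multinomial Finset.univ α : ℝ) ≤ (2 ^ Fintype.card σ) ^ ∑ i, α i := by
    exact_mod_cast Nat.multinomial_le_two_pow Finset.univ α
  rw [evalRadius, div_pow]
  refine div_le_div₀ (by positivity) ?_ h1 h2
  exact pow_le_pow_of_le_one hτ.le hτ1
    (Finset.single_le_sum (f := α) (fun _ _ => Nat.zero_le _) (Finset.mem_univ o))

end Weight

namespace WAlg

variable {I : Type*} [AddCommMonoid I]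

/-- Multiplication of the coefficients by a bounded multiplier. -/
noncomputable def diag (w : MonoidWeight I) (c : I → ℝ) (hc : ∀ α, |c α| ≤ 1) :
    WAlg w →L[ℝ] WAlg w :=
  lift (fun α => c α • mono w α) 1 fun α => by
    rw [norm_smul, norm_mono]
    exact mul_le_mul_of_nonneg_right (hc α) (w.pos α).le

theorem norm_diag_le {w : MonoidWeight I} (c : I → ℝ) (hc : ∀ α, |c α| ≤ 1) :
    ‖diag w c hc‖ ≤ 1 := norm_lift_le _ zero_le_one _

theorem diag_mono {w : MonoidWeight I} (c : I → ℝ) (hc : ∀ α, |c α| ≤ 1)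
    (α : I) : diag w c hc (mono w α) = c α • mono w α := lift_mono ..

section Fuchs

variable {σ : Type*} {o : σ}

/-- The mean `a ↦ y_o⁻¹ ∂ₒ⁻¹ a` in the normal direction. -/
noncomputable def meanL (w : MonoidWeight (σ → ℕ)) (o : σ) : WAlg w →L[ℝ] WAlg w :=
  diag w (fun α => 1 / ((α o : ℝ) + 1)) fun α => by
    rw [abs_of_nonneg (by positivity), div_le_one (by positivity)]
    linarith [Nat.cast_nonneg (α := ℝ) (α o)]

/-- The inverse of the Fuchsian operator `1 + γ y_o⁻¹ ∂ₒ⁻¹`. -/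
noncomputable def fuchsInv (w : MonoidWeight (σ → ℕ)) (o : σ) (γ : ℝ) (hγ : 0 ≤ γ) :
    WAlg w →L[ℝ] WAlg w :=
  diag w (fun α => ((α o : ℝ) + 1) / ((α o : ℝ) + 1 + γ)) fun α => by
    rw [abs_of_nonneg (by positivity), div_le_one (by positivity)]
    linarith

theorem norm_meanL_le {w : MonoidWeight (σ → ℕ)} : ‖meanL w o‖ ≤ 1 := norm_diag_le _ _

theorem norm_fuchsInv_le {w : MonoidWeight (σ → ℕ)} {γ : ℝ} (hγ : 0 ≤ γ) :
    ‖fuchsInv w o γ hγ‖ ≤ 1 := norm_diag_le _ _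

/-- `fuchsInv` inverts `1 + γ H`, where `H` is the mean operator `meanL`. -/
theorem fuchsInv_eq_iff {w : MonoidWeight (σ → ℕ)} {γ : ℝ} (hγ : 0 ≤ γ) (a b : WAlg w) :
    a = fuchsInv w o γ hγ b ↔ a + γ • meanL w o a = b := by
  have h1 : (fuchsInv w o γ hγ).comp (ContinuousLinearMap.id ℝ _ + γ • meanL w o)
      = ContinuousLinearMap.id ℝ _ := clm_ext fun α => by
    simp only [ContinuousLinearMap.comp_apply, _root_.add_apply, _root_.smul_apply,
      ContinuousLinearMap.id_apply, fuchsInv, meanL, diag_mono, map_add, map_smul, smul_smul,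
      ← add_smul]
    convert one_smul ℝ _
    field_simp
  have h2 : (ContinuousLinearMap.id ℝ _ + γ • meanL w o).comp (fuchsInv w o γ hγ)
      = ContinuousLinearMap.id ℝ _ := clm_ext fun α => by
    simp only [ContinuousLinearMap.comp_apply, _root_.add_apply, _root_.smul_apply,
      ContinuousLinearMap.id_apply, fuchsInv, meanL, diag_mono, map_smul, smul_smul]
    rw [smul_add, smul_smul, ← add_smul]
    convert one_smul ℝ _
    field_simp
  constructor
  · rintro rfl
    exact DFunLike.congr_fun h2 b
  · rintro rfl
    exact (DFunLike.congr_fun h1 a).symm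

end Fuchs

end WAlg

/-! ### Integration and differentiation operators -/

namespace WAlg

variable {σ : Type*} [Fintype σ] [DecidableEq σ] {o : σ} {τ : ℝ} {hτ : 0 < τ}

theorem single_normal_weight (α : σ → ℕ) :
    (multiWeight o τ hτ).val (α + eIdx o) * (∑ i, α i + 1 : ℕ)
      = τ * (α o + 1) * (multiWeight o τ hτ).val α := by
  rw [multiWeight_add_single, if_pos rfl]

theorem norm_intMono_le (hτ1 : τ ≤ 1) (α : σ → ℕ) :
    ‖(1 / ((α o : ℝ) + 1)) • mono (multiWeight o τ hτ) (α + eIdx o)‖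
      ≤ 1 * (multiWeight o τ hτ).val α := by
  have h := single_normal_weight (hτ := hτ) (o := o) α
  have hp := (multiWeight o τ hτ).pos α
  have hp' := (multiWeight o τ hτ).pos (α + eIdx o)
  rw [norm_smul, norm_mono, Real.norm_of_nonneg (by positivity), one_mul, one_div,
    inv_mul_le_iff₀ (by positivity)]
  have h1 : (1 : ℝ) ≤ (∑ i, α i + 1 : ℕ) := by norm_cast; omega
  calc _ ≤ (multiWeight o τ hτ).val (α + eIdx o) * (∑ i, α i + 1 : ℕ) :=
        le_mul_of_one_le_right hp'.le h1
    _ = τ * ((α o + 1) * (multiWeight o τ hτ).val α) := by rw [h]; ring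
    _ ≤ _ := mul_le_of_le_one_left (by positivity) hτ1

/-- The integral `∂ₒ⁻¹` in the normal direction, vanishing on `{y_o = 0}`. -/
noncomputable def intL (hτ1 : τ ≤ 1) : WAlg (multiWeight o τ hτ) →L[ℝ] WAlg (multiWeight o τ hτ) :=
  lift (fun α => (1 / ((α o : ℝ) + 1)) • mono _ (α + eIdx o)) 1 (norm_intMono_le hτ1)

/-- For `k ≠ o` the operator `∂ₖ ∂ₒ⁻¹` replaces one factor `y_k` by `y_o`. The ratio of the two
multinomial weights cancels the factor `αₖ / (αₒ + 1)` produced by `∂ₖ` and `∂ₒ⁻¹`, and `τ`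
remains. -/
theorem norm_derivMono_le (k : σ) (α : σ → ℕ) :
    ‖(((α + eIdx o) k : ℕ) / ((α o : ℝ) + 1)) •
        mono (multiWeight o τ hτ) (α + eIdx o - eIdx k)‖
      ≤ (if k = o then 1 else τ) * (multiWeight o τ hτ).val α := by
  rw [norm_smul, norm_mono, Real.norm_of_nonneg (by positivity)]
  have hp := (multiWeight o τ hτ).pos α
  rcases Nat.eq_zero_or_pos ((α + eIdx o) k) with h0 | h0
  · rw [h0]
    simp only [Nat.cast_zero, zero_div, zero_mul]
    split_ifs <;> positivity
  · by_cases hk : k = o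
    · subst hk
      rw [add_tsub_cancel_right, if_pos rfl]
      simp only [Pi.add_apply, Pi.single_eq_same, Nat.cast_add, Nat.cast_one]
      rw [div_self (by positivity)]
    · obtain ⟨β, hβ⟩ : ∃ β, α + eIdx o = β + eIdx k := by
        refine ⟨α + eIdx o - eIdx k, (tsub_add_cancel_of_le fun i => ?_).symm⟩
        by_cases hi : i = k
        · subst hi; simpa only [Pi.single_eq_same] using Nat.succ_le_of_lt h0
        · simp [hi]
      have h1 := single_normal_weight (hτ := hτ) (o := o) α
      have h2 := multiWeight_add_single (hτ := hτ) (o := o) β k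
      have hs : ∑ i, α i = ∑ i, β i := by
        have := congrArg (fun f : σ → ℕ => ∑ i, f i) hβ
        simpa [Finset.sum_add_distrib, Finset.sum_pi_single'] using this
      rw [if_neg hk, one_mul, ← hs, ← hβ, h1] at h2
      rw [hβ, add_tsub_cancel_right, if_neg hk, div_mul_eq_mul_div, div_le_iff₀ (by positivity)]
      simp only [Pi.add_apply, Pi.single_eq_same, Nat.cast_add, Nat.cast_one]
      rw [← h2]
      exact le_of_eq (by ring)

/-- The operator `∂ₖ ∂ₒ⁻¹`. -/
noncomputable def derivInt (k : σ) : WAlg (multiWeight o τ hτ) →L[ℝ] WAlg (multiWeight o τ hτ) :=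
  lift (fun α => (((α + eIdx o) k : ℕ) / ((α o : ℝ) + 1)) •
    mono _ (α + eIdx o - eIdx k)) _ (norm_derivMono_le k)

theorem norm_derivInt_le (k : σ) : ‖derivInt (hτ := hτ) (o := o) k‖ ≤ if k = o then 1 else τ :=
  norm_lift_le _ (by split_ifs <;> positivity) _

theorem derivInt_normal : derivInt (hτ := hτ) (o := o) o = ContinuousLinearMap.id ℝ _ :=
  clm_ext fun α => by
    rw [derivInt, lift_mono, add_tsub_cancel_right]
    simp only [Pi.add_apply, Pi.single_eq_same, Nat.cast_add, Nat.cast_one]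
    rw [div_self (by positivity), one_smul]
    rfl

theorem derivInt_intL (hτ1 : τ ≤ 1) (k : σ) (a : WAlg (multiWeight o τ hτ)) :
    derivInt k (intL hτ1 a) = intL hτ1 (derivInt k a) := by
  by_cases hk : k = o
  · subst hk; simp only [derivInt_normal]; rfl
  suffices h : (derivInt k).comp (intL hτ1) = (intL (hτ := hτ) (o := o) hτ1).comp
    (derivInt k) from DFunLike.congr_fun h a
  refine clm_ext fun α => ?_
  simp only [ContinuousLinearMap.comp_apply, intL, derivInt, lift_mono, map_smul]
  have e1 : (α + eIdx o + eIdx o) k = α k := by simp [hk]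
  have e2 : (α + eIdx o) k = α k := by simp [hk]
  have e3 : (α + eIdx o - eIdx k) o = α o + 1 := by simp [Ne.symm hk]
  have e4 : (α + eIdx o) o = α o + 1 := by simp
  rw [e1, e2, e3, e4, smul_smul, smul_smul]
  rcases Nat.eq_zero_or_pos (α k) with h0 | h0
  · simp [h0]
  · congr 1
    · ring
    · congr 1
      funext i
      by_cases hi : i = k
      · subst hi; simp [hk]
      · simp [hi]

end WAlg

/-! ### Evaluation of elements of the weighted algebra as analytic functions -/

section Words

variable {σ : Type*} [Fintype σ]

/-- The monomial `y^α`. -/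
noncomputable def monoEval (y : EuclideanSpace ℝ σ) (α : σ → ℕ) : ℝ := ∏ i, y i ^ α i

theorem monoEval_add (y : EuclideanSpace ℝ σ) (α β : σ → ℕ) :
    monoEval y (α + β) = monoEval y α * monoEval y β := by
  simp [monoEval, pow_add, Finset.prod_mul_distrib]

variable [DecidableEq σ]

theorem monoEval_single (y : EuclideanSpace ℝ σ) (k : σ) : monoEval y (eIdx k) = y k := by
  rw [monoEval, Finset.prod_eq_single k] <;> simp +contextual

theorem exists_word (N : ℕ) (α : σ → ℕ) (h : ∑ i, α i = N) :
    ∃ w : Fin N → σ, ∀ y : EuclideanSpace ℝ σ, ∏ i, y (w i) = monoEval y α := by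
  induction N generalizing α with
  | zero =>
    have : α = 0 := funext fun i => by simpa using (Finset.sum_eq_zero_iff.1 h) i (Finset.mem_univ i)
    exact ⟨Fin.elim0, fun y => by simp [this, monoEval]⟩
  | succ N ih =>
    obtain ⟨k, hk⟩ : ∃ k, α k ≠ 0 := by
      by_contra! h0
      simp [h0] at h
    have hα : α = (α - eIdx k) + eIdx k := by
      refine (tsub_add_cancel_of_le fun i => ?_).symm
      by_cases hi : i = k
      · subst hi; simpa using Nat.one_le_iff_ne_zero.2 hk
      · simp [hi]
    obtain ⟨w, hw⟩ := ih (α - eIdx k) (by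
      rw [hα] at h
      simpa [Finset.sum_add_distrib, Finset.sum_pi_single'] using h)
    refine ⟨Fin.cons k w, fun y => ?_⟩
    rw [Fin.prod_univ_succ, hα, monoEval_add, monoEval_single]
    simp only [Fin.cons_zero, Fin.cons_succ, hw]
    rw [mul_comm]

/-- A multilinear form whose restriction to the diagonal is the monomial `y^α`. -/
noncomputable def monoForm (N : ℕ) (α : σ → ℕ) (h : ∑ i, α i = N) :
    EuclideanSpace ℝ σ [×N]→L[ℝ] ℝ :=
  (ContinuousMultilinearMap.mkPiAlgebra ℝ (Fin N) ℝ).compContinuousLinearMap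
    fun i => EuclideanSpace.proj (Classical.choose (exists_word N α h) i)

theorem monoForm_diag (N : ℕ) (α : σ → ℕ) (h : ∑ i, α i = N) (y : EuclideanSpace ℝ σ) :
    monoForm N α h (fun _ => y) = monoEval y α := by
  simpa [monoForm] using Classical.choose_spec (exists_word N α h) y

theorem abs_monoForm_le (N : ℕ) (α : σ → ℕ) (h : ∑ i, α i = N) (y : Fin N → EuclideanSpace ℝ σ) :
    |monoForm N α h y| ≤ ∏ i, ‖y i‖ := by
  simp only [monoForm, ContinuousMultilinearMap.compContinuousLinearMap_apply,
    ContinuousMultilinearMap.mkPiAlgebra_apply, Finset.abs_prod]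
  exact Finset.prod_le_prod (fun _ _ => abs_nonneg _) fun i _ => EuclideanSpace.norm_eq (y i) ▸
    (by simpa [EuclideanSpace.norm_eq] using PiLp.norm_apply_le (y i) _)

theorem abs_monoEval_le (y : EuclideanSpace ℝ σ) (α : σ → ℕ) :
    |monoEval y α| ≤ ‖y‖ ^ ∑ i, α i := by
  rw [← monoForm_diag _ α rfl]
  simpa using abs_monoForm_le _ α rfl fun _ => y

theorem fderiv_monoEval (y : EuclideanSpace ℝ σ) (α : σ → ℕ) (k : σ) :
    fderiv ℝ (fun z => monoEval z α) y (EuclideanSpace.single k 1)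
      = α k * monoEval y (α - eIdx k) := by
  have hd : DifferentiableAt ℝ (fun z : EuclideanSpace ℝ σ => monoEval z α) y := by
    unfold monoEval; fun_prop
  rw [← hd.lineDeriv_eq_fderiv, lineDeriv]
  have e : (fun t : ℝ => monoEval (y + t • EuclideanSpace.single k (1 : ℝ)) α)
      = fun t => (y k + t) ^ α k * ∏ i ∈ Finset.univ.erase k, y i ^ α i := by
    funext t
    rw [monoEval, ← Finset.mul_prod_erase _ _ (Finset.mem_univ k)]
    congr 1
    · simp
    · refine Finset.prod_congr rfl fun i hi => ?_
      simp [Finset.ne_of_mem_erase hi]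
  have h1 : HasDerivAt (fun t : ℝ => (y k + t) ^ α k) (α k * (y k + 0) ^ (α k - 1) * 1) 0 :=
    ((hasDerivAt_id (0 : ℝ)).const_add (y k)).pow (α k)
  rw [e, (h1.mul_const _).deriv, monoEval, ← Finset.mul_prod_erase _ _ (Finset.mem_univ k)]
  have : ∀ i ∈ Finset.univ.erase k, y i ^ (α - eIdx k) i = y i ^ α i := fun i hi => by
    simp [Finset.ne_of_mem_erase hi]
  rw [Finset.prod_congr rfl this]
  simp
  ring

end Words

namespace WAlg

section

variable {σ : Type*}

open Classical in
/-- The coefficient functional. -/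
noncomputable def coeffL (w : MonoidWeight (σ → ℕ)) (α : σ → ℕ) : WAlg w →L[ℝ] ℝ :=
  lift (fun β => if β = α then 1 else 0) (1 / w.val α) fun β => by
    have := w.pos β
    have := w.pos α
    split_ifs with h
    · subst h; rw [norm_one, one_div_mul_cancel (w.pos β).ne']
    · rw [norm_zero]; positivity

open Classical in
theorem coeffL_mono {w : MonoidWeight (σ → ℕ)} (α β : σ → ℕ) :
    coeffL w α (mono w β) = if β = α then 1 else 0 := lift_mono ..

theorem coeffL_apply {w : MonoidWeight (σ → ℕ)} (α : σ → ℕ) (a : WAlg w) :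
    coeffL w α a = coeff a α := by
  classical
  have h := (hasSum_mono a).mapL (coeffL w α)
  simp only [map_smul, coeffL_mono] at h
  refine h.unique ?_
  convert hasSum_single α fun β hβ => ?_ using 1 <;> simp_all

end

variable {σ : Type*} [Fintype σ] [DecidableEq σ] {o : σ} {τ : ℝ} {hτ : 0 < τ}

/-- The power series at `0` of `y ↦ (a ↦ ∑ coeff a α y^α)`, as a function with values in the dual
of the algebra. -/
noncomputable def evSeries (w : MonoidWeight (σ → ℕ)) :
    FormalMultilinearSeries ℝ (EuclideanSpace ℝ σ) (WAlg w →L[ℝ] ℝ) := fun N =>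
  ∑ α ∈ (Finset.univ.piAntidiag N).attach,
    (monoForm N α.1 (Finset.mem_piAntidiag.1 α.2).1).smulRight (coeffL w α.1)

theorem evSeries_mono {w : MonoidWeight (σ → ℕ)} (N : ℕ) (y : Fin N → EuclideanSpace ℝ σ)
    (β : σ → ℕ) :
    evSeries w N y (mono w β) = if h : ∑ i, β i = N then monoForm N β h y else 0 := by
  simp only [evSeries, _root_.sum_apply, ContinuousMultilinearMap.smulRight_apply,
    _root_.smul_apply, coeffL_mono, smul_eq_mul, mul_ite, mul_one, mul_zero]
  split_ifs with h
  · have hm : β ∈ Finset.univ.piAntidiag N := Finset.mem_piAntidiag.2 ⟨h, by simp⟩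
    rw [Finset.sum_eq_single ⟨β, hm⟩]
    · simp
    · intro b _ hb
      rw [if_neg]
      rintro rfl
      exact hb rfl
    · simp
  · refine Finset.sum_eq_zero fun b _ => ?_
    rw [if_neg]
    rintro rfl
    exact h (Finset.mem_piAntidiag.1 b.2).1

/-- Evaluation at a point, as an element of the dual space. -/
noncomputable def ev (w : MonoidWeight (σ → ℕ)) (y : EuclideanSpace ℝ σ) : WAlg w →L[ℝ] ℝ :=
  (evSeries w).sum y

theorem norm_evSeries_mul_pow_le (hτ1 : τ ≤ 1) (N : ℕ) :
    ‖evSeries (multiWeight o τ hτ) N‖ * evalRadius σ τ ^ N ≤ 1 := by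
  have hρ : 0 < evalRadius σ τ := evalRadius_pos hτ
  rw [← le_div_iff₀ (pow_pos hρ N)]
  refine ContinuousMultilinearMap.opNorm_le_bound (by positivity) fun y => ?_
  refine norm_clm_le (by positivity) fun β => ?_
  have hw := (multiWeight o τ hτ).pos β
  rw [evSeries_mono]
  split_ifs with h
  · have h1 : 1 ≤ 1 / evalRadius σ τ ^ N * (multiWeight o τ hτ).val β := by
      rw [one_div_mul_eq_div, le_div_iff₀ (by positivity), one_mul, ← h]
      exact evalRadius_pow_le hτ1 β
    calc _ ≤ ∏ i, ‖y i‖ := abs_monoForm_le N β h y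
      _ ≤ (∏ i, ‖y i‖) * (1 / evalRadius σ τ ^ N * (multiWeight o τ hτ).val β) :=
        le_mul_of_one_le_right (by positivity) h1
      _ = _ := by ring
  · rw [norm_zero]; positivity

theorem hasFPowerSeriesOnBall_ev (hτ1 : τ ≤ 1) :
    HasFPowerSeriesOnBall (ev (multiWeight o τ hτ)) (evSeries (multiWeight o τ hτ)) 0
      (ENNReal.ofReal (evalRadius σ τ)) := by
  have hρ : 0 < evalRadius σ τ := evalRadius_pos hτ
  have h1 : ENNReal.ofReal (evalRadius σ τ) ≤ (evSeries (multiWeight o τ hτ)).radius := by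
    refine FormalMultilinearSeries.le_radius_of_bound _ 1 fun N => ?_
    rw [Real.coe_toNNReal _ hρ.le]
    exact norm_evSeries_mul_pow_le hτ1 N
  have h0 : 0 < ENNReal.ofReal (evalRadius σ τ) := ENNReal.ofReal_pos.2 hρ
  have h2 := (evSeries (multiWeight o τ hτ)).hasFPowerSeriesOnBall (h0.trans_le h1)
  exact h2.mono h0 h1

/-- The ball on which elements of the algebra are evaluated. -/
abbrev evBall (σ : Type*) [Fintype σ] (τ : ℝ) : Set (EuclideanSpace ℝ σ) :=
  Metric.ball 0 (evalRadius σ τ)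

theorem analyticOnNhd_ev (hτ1 : τ ≤ 1) :
    AnalyticOnNhd ℝ (ev (multiWeight o τ hτ)) (evBall σ τ) := by
  have := (hasFPowerSeriesOnBall_ev (o := o) (hτ := hτ) hτ1).analyticOnNhd
  rwa [Metric.eball_ofReal] at this

theorem ev_mono (hτ1 : τ ≤ 1) {y : EuclideanSpace ℝ σ} (hy : y ∈ evBall σ τ) (α : σ → ℕ) :
    ev (multiWeight o τ hτ) y (mono _ α) = monoEval y α := by
  have h := (hasFPowerSeriesOnBall_ev (o := o) (hτ := hτ) hτ1).hasSum
    (y := y) (by rwa [Metric.eball_ofReal])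
  rw [zero_add] at h
  have h' := h.mapL (ContinuousLinearMap.apply ℝ ℝ (mono (multiWeight o τ hτ) α))
  simp only [ContinuousLinearMap.apply_apply, evSeries_mono] at h'
  refine h'.unique ?_
  convert hasSum_single (∑ i, α i) fun N hN => ?_ using 1
  · simp [monoForm_diag]
  · rw [dif_neg hN.symm]

theorem abs_ev_le (hτ1 : τ ≤ 1) {y : EuclideanSpace ℝ σ} (hy : y ∈ evBall σ τ)
    (a : WAlg (multiWeight o τ hτ)) : ‖ev (multiWeight o τ hτ) y a‖ ≤ ‖a‖ := by
  have h : ‖ev (multiWeight o τ hτ) y‖ ≤ 1 := norm_clm_le zero_le_one fun α => by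
    rw [ev_mono hτ1 hy, one_mul]
    refine (abs_monoEval_le y α).trans (le_trans ?_ (evalRadius_pow_le hτ1 α))
    exact pow_le_pow_left₀ (norm_nonneg _) (mem_ball_zero_iff.1 hy).le _
  exact ((ev _ y).le_opNorm a).trans (mul_le_of_le_one_left (norm_nonneg _) h)

theorem ev_mul (hτ1 : τ ≤ 1) {y : EuclideanSpace ℝ σ} (hy : y ∈ evBall σ τ)
    (a b : WAlg (multiWeight o τ hτ)) : ev _ y (a * b) = ev _ y a * ev _ y b := by
  have h1 : ∀ α, (ev _ y).comp (mulL (multiWeight o τ hτ) (mono _ α)) =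
      (ev (multiWeight o τ hτ) y (mono _ α)) • ev _ y := fun α => clm_ext fun β => by
    simp only [ContinuousLinearMap.comp_apply, mulL_mono, _root_.smul_apply, ev_mono hτ1 hy,
      monoEval_add, smul_eq_mul]
  have h2 : (ev _ y).comp ((mulL (multiWeight o τ hτ)).flip b) = (ev _ y b) • ev _ y :=
    clm_ext fun α => by
      have := DFunLike.congr_fun (h1 α) b
      simpa [mul_comm] using this
  have := DFunLike.congr_fun h2 a
  rw [mul_eq_mulL]
  simpa [mul_comm] using this

theorem ev_one (hτ1 : τ ≤ 1) {y : EuclideanSpace ℝ σ} (hy : y ∈ evBall σ τ) :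
    ev (multiWeight o τ hτ) y 1 = 1 := by
  rw [one_eq_mono, ev_mono hτ1 hy]; simp [monoEval]

/-- Evaluation at a point of the ball as a character of the algebra. -/
noncomputable def evHom (hτ1 : τ ≤ 1) {y : EuclideanSpace ℝ σ} (hy : y ∈ evBall σ τ) :
    WAlg (multiWeight o τ hτ) →ₐ[ℝ] ℝ :=
  AlgHom.ofLinearMap (ev _ y).toLinearMap (ev_one hτ1 hy) (ev_mul hτ1 hy)

theorem evHom_apply (hτ1 : τ ≤ 1) {y : EuclideanSpace ℝ σ} (hy : y ∈ evBall σ τ)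
    (a : WAlg (multiWeight o τ hτ)) : evHom hτ1 hy a = ev _ y a := rfl

theorem analyticAt_ev_apply (hτ1 : τ ≤ 1) {y : EuclideanSpace ℝ σ} (hy : y ∈ evBall σ τ)
    (a : WAlg (multiWeight o τ hτ)) : AnalyticAt ℝ (fun z => ev _ z a) y :=
  ((ContinuousLinearMap.apply ℝ ℝ a).analyticAt _).comp (analyticOnNhd_ev hτ1 y hy)

theorem partialDeriv_ev_intL {d : ℕ} {o : Fin d} (hτ1 : τ ≤ 1) {y : EuclideanSpace ℝ (Fin d)}
    (hy : y ∈ evBall (Fin d) τ) (k : Fin d) (a : WAlg (multiWeight o τ hτ)) :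
    DegenerateSystem.partialDeriv k (fun z => ev _ z (intL hτ1 a)) y = ev _ y (derivInt k a) := by
  have hd := (analyticOnNhd_ev (o := o) (hτ := hτ) hτ1 y hy).differentiableAt
  have key : ∀ b, DegenerateSystem.partialDeriv k (fun z => ev (multiWeight o τ hτ) z b) y
      = fderiv ℝ (ev (multiWeight o τ hτ)) y (EuclideanSpace.single k 1) b := fun b => by
    have := ((ContinuousLinearMap.apply ℝ ℝ b).hasFDerivAt.comp y hd.hasFDerivAt).fderiv
    exact DFunLike.congr_fun this (EuclideanSpace.single k 1)
  have h : (fderiv ℝ (ev (multiWeight o τ hτ)) y (EuclideanSpace.single k 1)).comp (intL hτ1)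
      = (ev _ y).comp (derivInt k) := clm_ext fun α => by
    simp only [ContinuousLinearMap.comp_apply, intL, derivInt, lift_mono, map_smul]
    rw [ev_mono hτ1 hy, ← key]
    have : (fun z => ev (multiWeight o τ hτ) z (mono _ (α + eIdx o))) =ᶠ[𝓝 y]
        fun z => monoEval z (α + eIdx o) := by
      filter_upwards [Metric.isOpen_ball.mem_nhds hy] with z hz using ev_mono hτ1 hz _
    rw [DegenerateSystem.partialDeriv, this.fderiv_eq, fderiv_monoEval]
    simp only [smul_eq_mul]
    ring
  rw [key]
  exact DFunLike.congr_fun h a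

theorem ev_intL_of_normal_eq_zero (hτ1 : τ ≤ 1) {y : EuclideanSpace ℝ σ} (hy : y ∈ evBall σ τ)
    (h0 : y o = 0) (a : WAlg (multiWeight o τ hτ)) : ev _ y (intL hτ1 a) = 0 := by
  have h : (ev _ y).comp (intL (hτ := hτ) (o := o) hτ1) = 0 := clm_ext fun α => by
    simp [intL, lift_mono, ev_mono hτ1 hy, monoEval_add, monoEval_single, h0]
  exact DFunLike.congr_fun h a

theorem ev_meanL (hτ1 : τ ≤ 1) {y : EuclideanSpace ℝ σ} (hy : y ∈ evBall σ τ)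
    (a : WAlg (multiWeight o τ hτ)) : y o * ev _ y (meanL _ o a) = ev _ y (intL hτ1 a) := by
  have h : (y o) • (ev _ y).comp (meanL _ o) = (ev _ y).comp (intL (hτ := hτ) (o := o) hτ1) :=
    clm_ext fun α => by
      simp [intL, meanL, diag_mono, lift_mono, ev_mono hτ1 hy, monoEval_add, monoEval_single]
      ring
  exact DFunLike.congr_fun h a

/-- An element of the algebra is determined by its values near any point of the ball. -/
theorem eq_zero_of_ev (hτ1 : τ ≤ 1) {a : WAlg (multiWeight o τ hτ)} {y : EuclideanSpace ℝ σ}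
    (hy : y ∈ evBall σ τ) (h : ∀ᶠ z in 𝓝 y, ev _ z a = 0) : a = 0 := by
  have hρ : 0 < evalRadius σ τ := evalRadius_pos hτ
  have hz : Set.EqOn (fun z => ev _ z a) 0 (evBall σ τ) :=
    AnalyticOnNhd.eqOn_zero_of_preconnected_of_eventuallyEq_zero
      (fun z hz => analyticAt_ev_apply hτ1 hz a) (convex_ball _ _).isPreconnected hy h
  have hs := (ContinuousLinearMap.apply ℝ ℝ a).comp_hasFPowerSeriesOnBall
    (hasFPowerSeriesOnBall_ev (o := o) (hτ := hτ) hτ1)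
  have h0 : HasFPowerSeriesAt (0 : EuclideanSpace ℝ σ → ℝ) _ 0 :=
    hs.hasFPowerSeriesAt.congr (by
      filter_upwards [Metric.ball_mem_nhds (0 : EuclideanSpace ℝ σ) hρ] with z hz' using hz hz')
  refine eq_zero_of_coeff fun α => ?_
  set N := ∑ i, α i with hN
  let P : MvPolynomial σ ℝ := ∑ β ∈ Finset.univ.piAntidiag N,
    MvPolynomial.monomial (Finsupp.equivFunOnFinite.symm β) (coeff a β)
  have hP : P = 0 := MvPolynomial.funext fun x => by
    have := h0.apply_eq_zero N (WithLp.toLp 2 x)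
    simp only [ContinuousLinearMap.compFormalMultilinearSeries_apply,
      ContinuousLinearMap.compContinuousMultilinearMap_coe, Function.comp_apply,
      ContinuousLinearMap.apply_apply, evSeries, _root_.sum_apply,
      ContinuousMultilinearMap.smulRight_apply, _root_.smul_apply, coeffL_apply, monoForm_diag,
      smul_eq_mul] at this
    rw [map_zero, ← this, Finset.sum_attach (Finset.univ.piAntidiag N)
      fun β => monoEval (WithLp.toLp 2 x) β * coeff a β, map_sum]
    refine Finset.sum_congr rfl fun β _ => ?_
    rw [MvPolynomial.eval_monomial, Finsupp.prod_fintype _ _ (by simp), mul_comm]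
    rfl
  have hc := congrArg (MvPolynomial.coeff (Finsupp.equivFunOnFinite.symm α)) hP
  rw [MvPolynomial.coeff_zero, MvPolynomial.coeff_sum, Finset.sum_eq_single α] at hc
  · simpa using hc
  · intro b _ hb
    rw [MvPolynomial.coeff_monomial, if_neg]
    exact fun h => hb (Finsupp.equivFunOnFinite.symm.injective h)
  · intro h
    exact absurd (Finset.mem_piAntidiag.2 ⟨hN.symm, by simp⟩) h

end WAlg

/-! ### Rescaled analytic functions as elements of the algebra -/

namespace WAlg

variable {σ : Type*} [Fintype σ] [DecidableEq σ] {o : σ} {τ : ℝ} {hτ : 0 < τ}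

/-- The rescalings `y ↦ f (r y)` of an analytic function belong to the algebra for small `r`, and
they tend to the constant `f 0` as `r → 0`. -/
theorem exists_rescaling (hτ1 : τ ≤ 1) {f : EuclideanSpace ℝ σ → ℝ} (hf : AnalyticAt ℝ f 0) :
    ∃ a : ℝ → WAlg (multiWeight o τ hτ),
      Tendsto a (𝓝 0) (𝓝 (algebraMap ℝ _ (f 0))) ∧
      ∀ᶠ r in 𝓝 (0 : ℝ), ∀ y ∈ evBall σ τ, ev _ y (a r) = f (r • y) := by
  have hf' : AnalyticAt ℝ (fun x : σ → ℝ => f (WithLp.toLp 2 x)) 0 :=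
    AnalyticAt.comp (f := fun x : σ → ℝ => (WithLp.toLp 2 x : EuclideanSpace ℝ σ)) (x := 0) hf
      ((PiLp.continuousLinearEquiv 2 ℝ fun _ : σ => ℝ).symm.toContinuousLinearMap.analyticAt 0)
  obtain ⟨F, hF, hF0, ε, hε, hFε⟩ :=
    hf'.exists_functional_calculus (B := WAlg (multiWeight o τ hτ))
  have hc : Continuous fun (r : ℝ) (k : σ) => r • mono (multiWeight o τ hτ) (eIdx k) := by
    fun_prop
  have h0 : (fun k : σ => (0 : ℝ) • mono (multiWeight o τ hτ) (eIdx k)) = 0 := by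
    funext k; simp
  refine ⟨fun r => F fun k => r • mono _ (eIdx k), ?_, ?_⟩
  · have h1 : Tendsto F (𝓝 fun k : σ => (0 : ℝ) • mono (multiWeight o τ hτ) (eIdx k))
        (𝓝 (F 0)) := by rw [h0]; exact hF.continuousAt
    rw [hF0] at h1
    exact h1.comp (hc.tendsto 0)
  · have h1 : ∀ᶠ r in 𝓝 (0 : ℝ),
        ‖fun k : σ => r • mono (multiWeight o τ hτ) (eIdx k)‖ < ε :=
      (hc.norm.tendsto 0).eventually_lt_const (by rw [h0, norm_zero]; exact hε)
    filter_upwards [h1] with r hr y hy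
    have := hFε (evHom hτ1 hy) (fun a => abs_ev_le hτ1 hy a) _ hr
    rw [evHom_apply] at this
    rw [this]
    congr 1
    ext k
    simp [evHom_apply, ev_mono hτ1 hy, monoEval_single]

end WAlg

/-! ### Fixed points depending on parameters -/

section FixedPoint

variable {P V : Type*} [NormedAddCommGroup P] [NormedSpace ℝ P] [CompleteSpace P]
  [NormedAddCommGroup V] [NormedSpace ℝ V] [CompleteSpace V]
  {T : P × V → V} {T' : P × V →L[ℝ] V} {q : ℝ}

/-- Existence of a fixed point for every small parameter. The strict derivative of
`(p, U) ↦ (p, U - T (p, U))` at `0` is surjective by a Neumann series, so this map is open at `0`. -/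
theorem HasStrictFDerivAt.eventually_exists_fixedPoint (hT : HasStrictFDerivAt T T' 0)
    (h0 : T 0 = 0) (hq1 : q < 1) (hq : ∀ U, ‖T' (0, U)‖ ≤ q * ‖U‖) {s : Set V}
    (hs : s ∈ 𝓝 (0 : V)) : ∀ᶠ p in 𝓝 (0 : P), ∃ U ∈ s, U = T (p, U) := by
  set K : V →L[ℝ] V := T'.comp (ContinuousLinearMap.inr ℝ P V) with hK
  have hKn : ‖K‖ < 1 := by
    refine lt_of_le_of_lt (b := max q 0) (K.opNorm_le_bound (le_max_right _ _) fun U => ?_)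
      (max_lt hq1 one_pos)
    exact (hq U).trans (mul_le_mul_of_nonneg_right (le_max_left _ _) (norm_nonneg _))
  obtain ⟨u, hu⟩ := isUnit_one_sub_of_norm_lt_one hKn
  set G : P × V → P × V := fun x => (x.1, x.2 - T x) with hG
  have hG' : HasStrictFDerivAt G ((ContinuousLinearMap.fst ℝ P V).prod
      (ContinuousLinearMap.snd ℝ P V - T')) 0 :=
    hasStrictFDerivAt_fst.prodMk (hasStrictFDerivAt_snd.sub hT)
  have hsurj : ((ContinuousLinearMap.fst ℝ P V).prod
      (ContinuousLinearMap.snd ℝ P V - T')).range = ⊤ := by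
    rw [LinearMap.range_eq_top]
    rintro ⟨p, v⟩
    refine ⟨(p, (↑u⁻¹ : V →L[ℝ] V) (v + T' (p, 0))), ?_⟩
    set U := (↑u⁻¹ : V →L[ℝ] V) (v + T' (p, 0)) with hU
    have h1 : (1 - K) U = v + T' (p, 0) := by
      rw [← hu, hU, ← mul_apply_eq_comp, Units.mul_inv]; rfl
    have h2 : T' (p, U) = T' (p, 0) + T' (0, U) := by rw [← map_add]; simp
    have h3 : (1 - K) U = U - T' (0, U) := rfl
    refine Prod.ext rfl ?_
    change U - T' (p, U) = v
    rw [h2, ← sub_sub, sub_right_comm, ← h3, h1, add_sub_cancel_right]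
  have hmap := hG'.map_nhds_eq_of_surj hsurj
  have hG0 : G 0 = (0, 0) := by simp [hG, h0]
  have hmem : G '' (Set.univ ×ˢ s) ∈ 𝓝 ((0 : P), (0 : V)) := by
    rw [← hG0, ← hmap]
    exact image_mem_map (prod_mem_nhds univ_mem hs)
  have hc : Tendsto (fun p : P => (p, (0 : V))) (𝓝 0) (𝓝 (0, 0)) :=
    (Continuous.prodMk_left 0).tendsto 0
  filter_upwards [hc hmem] with p hp
  obtain ⟨⟨p', U⟩, ⟨-, hUs⟩, hpU⟩ := hp
  obtain ⟨rfl, h2⟩ := Prod.ext_iff.1 hpU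
  exact ⟨U, hUs, sub_eq_zero.1 h2⟩

omit [CompleteSpace P] [CompleteSpace V] in
/-- Uniqueness of small fixed points: near `0` the map `T` contracts differences in the second
variable. -/
theorem HasStrictFDerivAt.exists_unique_fixedPoint_nhds (hT : HasStrictFDerivAt T T' 0)
    (hq1 : q < 1) (hq : ∀ U, ‖T' (0, U)‖ ≤ q * ‖U‖) :
    ∃ N ∈ 𝓝 (0 : P × V), ∀ p U W, (p, U) ∈ N → (p, W) ∈ N → U = T (p, U) → W = T (p, W) →
      U = W := by
  have hlo := hT.isLittleO.def (c := (1 - q) / 2) (by linarith)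
  rw [nhds_prod_eq] at hlo
  obtain ⟨N, hN, hN2⟩ := (eventually_prod_self_iff (r := fun x y : P × V =>
    ‖T x - T y - T' (x - y)‖ ≤ (1 - q) / 2 * ‖x - y‖)).1 hlo
  refine ⟨N, hN, fun p U W hU hW hUT hWT => ?_⟩
  have h := hN2 (p, U) hU (p, W) hW
  simp only [← hUT, ← hWT, Prod.mk_sub_mk, sub_self] at h
  have h3 : ‖((0 : P), U - W)‖ = ‖U - W‖ := by simp [Prod.norm_def]
  rw [h3] at h
  have h4 := norm_sub_norm_le (U - W) (T' (0, U - W))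
  have h5 := hq (U - W)
  have h6 : ‖U - W‖ ≤ 0 := by nlinarith
  exact sub_eq_zero.1 (norm_le_zero_iff.1 h6)

end FixedPoint

/-! ### The fixed point equation -/

/-- As the factor `K` vanishes at `0`, only the value of the coefficient `F` at `0` enters the
derivative of the product. -/
theorem hasStrictFDerivAt_coeff_mul {B ι E : Type*} [NormedCommRing B]
    [NormedAlgebra ℝ B] [CompleteSpace B] [Fintype ι] [NormedAddCommGroup E] [NormedSpace ℝ E]
    {F : (ι → B) → B} {c : ℝ} (hF : AnalyticAt ℝ F 0)
    (hF0 : F 0 = algebraMap ℝ B c) {Z : E → ι → B} (hZ : ContDiff ℝ 1 Z) (hZ0 : Z 0 = 0)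
    {K : E → B} {K' : E →L[ℝ] B} (hK : HasStrictFDerivAt K K' 0) (hK0 : K 0 = 0) :
    HasStrictFDerivAt (fun x => F (Z x) * K x) (c • K') 0 := by
  have h1 : HasStrictFDerivAt F (fderiv ℝ F 0) (Z 0) := by
    rw [hZ0]; exact hF.hasStrictFDerivAt
  have h2 := h1.comp 0 ((hZ.contDiffAt (x := 0)).hasStrictFDerivAt one_ne_zero)
  refine (h2.mul hK).congr_fderiv (ContinuousLinearMap.ext fun x => ?_)
  simp [hK0, hZ0, hF0, Algebra.smul_def]

/-- The ingredients of the fixed point equation in a commutative Banach algebra `B`. The index type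
`μ` numbers the unknowns, `κ` the space variables, and `μ ⊕ μ × κ` the arguments `(s, p)` of the
nonlinearities. -/
structure FuchsData (B μ κ : Type*) [NormedCommRing B] [NormedAlgebra ℝ B] where
  /-- the normal coordinate -/
  o : κ
  /-- the integral `∂ₒ⁻¹` -/
  I : B →L[ℝ] B
  /-- the operators `∂ₖ ∂ₒ⁻¹` -/
  R : κ → B →L[ℝ] B
  /-- the operator `y_o⁻¹ ∂ₒ⁻¹` -/
  H : B →L[ℝ] B
  /-- the inverses of `1 + γⱼ H` -/
  L : μ → B →L[ℝ] B
  /-- the coefficients of the second order terms -/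
  a : μ → κ → κ → (μ ⊕ μ × κ → B) → B
  /-- the partial derivatives of the lower order terms -/
  g : μ → μ ⊕ μ × κ → (μ ⊕ μ × κ → B) → B

namespace FuchsData

/-- The parameters of the fixed point equation: value and gradient of the background function, its
Hessian, and the scaling factor. -/
abbrev Params (B μ κ : Type*) : Type _ := (μ ⊕ μ × κ → B) × (μ → κ → κ → B) × ℝ

variable {B μ κ : Type*} [NormedCommRing B] [NormedAlgebra ℝ B] (D : FuchsData B μ κ)

/-- Value and gradient of the background plus `r ∂ₒ⁻² U`. -/
noncomputable def jet (x : Params B μ κ × (μ → B)) : μ ⊕ μ × κ → B :=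
  Sum.elim (fun i => x.1.1 (.inl i) + x.1.2.2 • D.I (D.I (x.2 i)))
    fun ik => x.1.1 (.inr ik) + D.I (D.R ik.2 (x.2 ik.1))

/-- The Hessian of the background plus `∂ₒ⁻² U`. -/
noncomputable def hess (x : Params B μ κ × (μ → B)) (i : μ) (k l : κ) : B :=
  x.1.2.1 i k l + D.R k (D.R l (x.2 i))

/-- The normal derivative of `jet`. -/
noncomputable def jetNormal (x : Params B μ κ × (μ → B)) : μ ⊕ μ × κ → B :=
  Sum.elim (fun i => x.1.2.2 • D.jet x (.inr (i, D.o))) fun ik => D.hess x ik.1 D.o ik.2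

theorem jet_zero : D.jet 0 = 0 := by
  funext z
  rcases z with i | ik <;> simp [jet]

theorem hess_zero (i : μ) (k l : κ) : D.hess 0 i k l = 0 := by simp [hess]

theorem jetNormal_zero (z : μ ⊕ μ × κ) : D.jetNormal 0 z = 0 := by
  rcases z with i | ik <;> simp [jetNormal, hess_zero, jet_zero]

/-- `hess` as a continuous linear map. -/
noncomputable def hessL (i : μ) (k l : κ) : Params B μ κ × (μ → B) →L[ℝ] B :=
  ((((ContinuousLinearMap.proj l).comp (ContinuousLinearMap.proj k)).comp
    (ContinuousLinearMap.proj i)).comp ((ContinuousLinearMap.fst ℝ (μ → κ → κ → B) ℝ).comp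
      (ContinuousLinearMap.snd ℝ (μ ⊕ μ × κ → B) _))).comp (ContinuousLinearMap.fst ℝ _ _)
  + ((D.R k).comp (D.R l)).comp ((ContinuousLinearMap.proj i).comp (ContinuousLinearMap.snd ℝ _ _))

theorem hasStrictFDerivAt_hess (i : μ) (k l : κ) :
    HasStrictFDerivAt (fun x => D.hess x i k l) (D.hessL i k l) 0 :=
  (D.hessL i k l).hasStrictFDerivAt

theorem hessL_apply (i : μ) (k l : κ) (U : μ → B) :
    D.hessL i k l (0, U) = D.R k (D.R l (U i)) := zero_add _

variable [Fintype μ] [Fintype κ]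

/-- The second order part of the right hand side. -/
noncomputable def second (x : Params B μ κ × (μ → B)) (j : μ) : B :=
  ∑ k, ∑ l, D.a j k l (D.jet x) * D.hess x j k l

/-- The normal derivative of the lower order part of the right hand side. -/
noncomputable def lower (x : Params B μ κ × (μ → B)) (j : μ) : B :=
  ∑ z, D.g j z (D.jet x) * D.jetNormal x z

/-- The map whose fixed points `U = ∂ₒ² v` correspond to solutions of the system. -/
noncomputable def map (x : Params B μ κ × (μ → B)) (j : μ) : B :=
  D.L j (D.second x j + D.H (D.lower x j))

theorem map_zero : D.map 0 = 0 := by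
  funext j
  simp [map, second, lower, hess_zero, jetNormal_zero]

theorem contDiff_jet : ContDiff ℝ 1 D.jet := by
  refine contDiff_pi.2 fun z => ?_
  rcases z with i | ik
  · simp only [jet, Sum.elim_inl]
    fun_prop
  · simp only [jet, Sum.elim_inr]
    fun_prop

/-- The derivative of `jetNormal` at `0`. -/
noncomputable def jetNormalL : μ ⊕ μ × κ → Params B μ κ × (μ → B) →L[ℝ] B :=
  Sum.elim 0 fun ik => D.hessL ik.1 D.o ik.2

theorem hasStrictFDerivAt_jetNormal (z : μ ⊕ μ × κ) :
    HasStrictFDerivAt (fun x => D.jetNormal x z) (D.jetNormalL z) 0 := by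
  rcases z with i | ik
  · have hr : HasStrictFDerivAt (fun x : Params B μ κ × (μ → B) => x.1.2.2) _ 0 :=
      (((ContinuousLinearMap.snd ℝ (μ → κ → κ → B) ℝ).comp
      (ContinuousLinearMap.snd ℝ (μ ⊕ μ × κ → B) _)).comp
        (ContinuousLinearMap.fst ℝ _ (μ → B))).hasStrictFDerivAt
    have hj := ((contDiff_pi.1 D.contDiff_jet (.inr (i, D.o))).contDiffAt (x := 0)).hasStrictFDerivAt
      one_ne_zero
    have h := hr.smul hj
    have h0 : D.jet 0 (.inr (i, D.o)) = 0 := by rw [jet_zero]; rfl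
    refine h.congr_fderiv (ContinuousLinearMap.ext fun x => ?_)
    simp [h0, jetNormalL]
  · exact D.hasStrictFDerivAt_hess _ _ _

/-- The fixed point map is strictly differentiable at `0`. As the normal-normal coefficients vanish
at `0`, every second derivative which enters its derivative in the direction of the unknown carries
a factor `τ`. -/
theorem exists_hasStrictFDerivAt_map [CompleteSpace B] [DecidableEq κ] {τ : ℝ} (hτ : 0 ≤ τ)
    (hτ1 : τ ≤ 1)
    {c : μ → κ → κ → ℝ} {e : μ → μ ⊕ μ × κ → ℝ}
    (ha : ∀ j k l, AnalyticAt ℝ (D.a j k l) 0) (ha0 : ∀ j k l, D.a j k l 0 = algebraMap ℝ B (c j k l))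
    (hg : ∀ j z, AnalyticAt ℝ (D.g j z) 0) (hg0 : ∀ j z, D.g j z 0 = algebraMap ℝ B (e j z))
    (hc : ∀ j, c j D.o D.o = 0) (he : ∀ j i, e j (.inr (i, D.o)) = 0)
    (hR : ∀ k, ‖D.R k‖ ≤ if k = D.o then 1 else τ) (hH : ‖D.H‖ ≤ 1) (hL : ∀ j, ‖D.L j‖ ≤ 1) :
    ∃ T' : Params B μ κ × (μ → B) →L[ℝ] (μ → B), HasStrictFDerivAt D.map T' 0 ∧ ∀ U : μ → B,
      ‖T' (0, U)‖ ≤ τ * (∑ j, ((∑ k, ∑ l, |c j k l|) + ∑ z, |e j z|)) * ‖U‖ := by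
  have hsec : ∀ j, HasStrictFDerivAt (fun x => D.second x j)
      (∑ k, ∑ l, c j k l • D.hessL j k l) 0 := fun j =>
    HasStrictFDerivAt.fun_sum fun k _ => HasStrictFDerivAt.fun_sum fun l _ =>
      hasStrictFDerivAt_coeff_mul (ha j k l) (ha0 j k l) D.contDiff_jet D.jet_zero
        (D.hasStrictFDerivAt_hess j k l) (D.hess_zero j k l)
  have hlow : ∀ j, HasStrictFDerivAt (fun x => D.lower x j) (∑ z, e j z • D.jetNormalL z) 0 :=
    fun j => HasStrictFDerivAt.fun_sum fun z _ =>
      hasStrictFDerivAt_coeff_mul (hg j z) (hg0 j z) D.contDiff_jet D.jet_zero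
        (D.hasStrictFDerivAt_jetNormal z) (D.jetNormal_zero z)
  refine ⟨ContinuousLinearMap.pi fun j => (D.L j).comp ((∑ k, ∑ l, c j k l • D.hessL j k l) +
    D.H.comp (∑ z, e j z • D.jetNormalL z)), ?_, fun U => ?_⟩
  · exact hasStrictFDerivAt_pi.2 fun j => (D.L j).hasStrictFDerivAt.comp 0
      ((hsec j).add (D.H.hasStrictFDerivAt.comp 0 (hlow j)))
  have hRR : ∀ i k l, ¬ (k = D.o ∧ l = D.o) → ‖D.R k (D.R l (U i))‖ ≤ τ * ‖U‖ := by
    intro i k l hkl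
    have h1 : ‖D.R k (D.R l (U i))‖ ≤ ‖D.R k‖ * (‖D.R l‖ * ‖U‖) :=
      ((D.R k).le_opNorm _).trans (mul_le_mul_of_nonneg_left (((D.R l).le_opNorm _).trans
        (mul_le_mul_of_nonneg_left (norm_le_pi_norm U i) (norm_nonneg _))) (norm_nonneg _))
    rw [← mul_assoc] at h1
    refine h1.trans (mul_le_mul_of_nonneg_right ?_ (norm_nonneg _))
    have h2 := hR k
    have h3 := hR l
    have h4 := norm_nonneg (D.R k)
    have h5 := norm_nonneg (D.R l)
    split_ifs at h2 h3 with hk hl hl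
    · exact absurd ⟨hk, hl⟩ hkl
    all_goals nlinarith
  have hsec' : ∀ j, ‖∑ k, ∑ l, c j k l • D.R k (D.R l (U j))‖
      ≤ (∑ k, ∑ l, |c j k l|) * (τ * ‖U‖) := fun j => by
    simp only [Finset.sum_mul]
    refine norm_sum_le_of_le _ fun k _ => norm_sum_le_of_le _ fun l _ => ?_
    rw [norm_smul, Real.norm_eq_abs]
    by_cases hkl : k = D.o ∧ l = D.o
    · rw [hkl.1, hkl.2, hc]; simp
    · exact mul_le_mul_of_nonneg_left (hRR j k l hkl) (abs_nonneg _)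
  have hlow' : ∀ j, ‖∑ z, e j z • D.jetNormalL z (0, U)‖ ≤ (∑ z, |e j z|) * (τ * ‖U‖) :=
    fun j => by
    rw [Finset.sum_mul]
    refine norm_sum_le_of_le _ fun z _ => ?_
    rw [norm_smul, Real.norm_eq_abs]
    rcases z with i | ⟨i, k⟩
    · simp only [jetNormalL, Sum.elim_inl, Pi.zero_apply, _root_.zero_apply, norm_zero, mul_zero]
      positivity
    · by_cases hk : k = D.o
      · rw [hk, he]; simp
      · refine mul_le_mul_of_nonneg_left ?_ (abs_nonneg _)
        simp only [jetNormalL, Sum.elim_inr, hessL_apply]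
        exact hRR i D.o k fun h => hk h.2
  have hnn : 0 ≤ τ * (∑ j, ((∑ k, ∑ l, |c j k l|) + ∑ z, |e j z|)) * ‖U‖ := by positivity
  refine (pi_norm_le_iff_of_nonneg hnn).2 fun j => ?_
  have h1 : ‖D.L j ((∑ k, ∑ l, c j k l • D.R k (D.R l (U j)))
      + D.H (∑ z, e j z • D.jetNormalL z (0, U)))‖
      ≤ (∑ k, ∑ l, |c j k l|) * (τ * ‖U‖) + (∑ z, |e j z|) * (τ * ‖U‖) := by
    refine ((D.L j).le_opNorm _).trans ((mul_le_of_le_one_left (norm_nonneg _) (hL j)).trans ?_)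
    refine norm_add_le_of_le (hsec' j) ?_
    exact (D.H.le_opNorm _).trans ((mul_le_of_le_one_left (norm_nonneg _) hH).trans (hlow' j))
  have h2 : ((∑ k, ∑ l, |c j k l|) + ∑ z, |e j z|)
      ≤ ∑ j, ((∑ k, ∑ l, |c j k l|) + ∑ z, |e j z|) :=
    Finset.single_le_sum (f := fun j => (∑ k, ∑ l, |c j k l|) + ∑ z, |e j z|)
      (fun _ _ => by positivity) (Finset.mem_univ j)
  have h3 : (∑ k, ∑ l, |c j k l|) * (τ * ‖U‖) + (∑ z, |e j z|) * (τ * ‖U‖)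
      ≤ τ * (∑ j, ((∑ k, ∑ l, |c j k l|) + ∑ z, |e j z|)) * ‖U‖ := by
    calc _ = ((∑ k, ∑ l, |c j k l|) + ∑ z, |e j z|) * (τ * ‖U‖) := (add_mul _ _ _).symm
      _ ≤ (∑ j, ((∑ k, ∑ l, |c j k l|) + ∑ z, |e j z|)) * (τ * ‖U‖) :=
        mul_le_mul_of_nonneg_right h2 (by positivity)
      _ = _ := by ring
  refine le_trans (le_of_eq ?_) (h1.trans h3)
  simp only [ContinuousLinearMap.pi_apply, ContinuousLinearMap.comp_apply, _root_.add_apply,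
    _root_.sum_apply, _root_.smul_apply, hessL_apply]

end FuchsData

/-! ### The system in terms of the algebra -/

namespace DegenerateSystem

section Calculus

variable {n : ℕ} {f g : EuclideanSpace ℝ (Fin n) → ℝ} {y : EuclideanSpace ℝ (Fin n)}

theorem partialDeriv_comp_smul (k : Fin n) (r : ℝ) :
    partialDeriv k (fun z => f (r • z)) y = r * partialDeriv k f (r • y) := by
  rw [partialDeriv, fderiv_comp_smul]
  rfl

theorem partialDeriv_congr (k : Fin n) (h : f =ᶠ[𝓝 y] g) :
    partialDeriv k f y = partialDeriv k g y := by
  rw [partialDeriv, h.fderiv_eq]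
  rfl

theorem _root_.AnalyticAt.partialDeriv (hf : AnalyticAt ℝ f y) (k : Fin n) :
    AnalyticAt ℝ (partialDeriv k f) y :=
  ((ContinuousLinearMap.apply ℝ ℝ (EuclideanSpace.single k (1 : ℝ))).analyticAt _).comp hf.fderiv

theorem partialDeriv_add (k : Fin n) (hf : DifferentiableAt ℝ f y) (hg : DifferentiableAt ℝ g y) :
    partialDeriv k (fun z => f z + g z) y = partialDeriv k f y + partialDeriv k g y := by
  rw [partialDeriv, fderiv_fun_add hf hg]
  rfl

theorem partialDeriv_sub (k : Fin n) (hf : DifferentiableAt ℝ f y) (hg : DifferentiableAt ℝ g y) :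
    partialDeriv k (fun z => f z - g z) y = partialDeriv k f y - partialDeriv k g y := by
  rw [partialDeriv, fderiv_fun_sub hf hg]
  rfl

theorem partialDeriv_const_mul (k : Fin n) (c : ℝ) (hf : DifferentiableAt ℝ f y) :
    partialDeriv k (fun z => c * f z) y = c * partialDeriv k f y := by
  rw [partialDeriv, fderiv_const_mul hf]
  rfl

/-- The chain rule for an outer function on `ℝ^J`. -/
theorem partialDeriv_comp {J : Type*} [Fintype J] [DecidableEq J] {G : (J → ℝ) → ℝ}
    {ζ : EuclideanSpace ℝ (Fin n) → J → ℝ} (k : Fin n) (hG : DifferentiableAt ℝ G (ζ y))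
    (hζ : ∀ z, DifferentiableAt ℝ (fun w => ζ w z) y) :
    partialDeriv k (fun w => G (ζ w)) y
      = ∑ z, fderiv ℝ G (ζ y) (Pi.single z 1) * partialDeriv k (fun w => ζ w z) y := by
  have h1 : HasFDerivAt ζ (ContinuousLinearMap.pi fun z => fderiv ℝ (fun w => ζ w z) y) y :=
    hasFDerivAt_pi.2 fun z => (hζ z).hasFDerivAt
  have h2 := (hG.hasFDerivAt.comp y h1).fderiv
  have h3 := DFunLike.congr_fun h2 (EuclideanSpace.single k 1)
  refine h3.trans ?_
  rw [ContinuousLinearMap.comp_apply]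
  conv_lhs => rw [pi_eq_sum_univ' ((ContinuousLinearMap.pi fun z => fderiv ℝ (fun w => ζ w z) y)
    (EuclideanSpace.single k 1)), map_sum]
  refine Finset.sum_congr rfl fun z _ => ?_
  rw [map_smul, smul_eq_mul, mul_comm]
  rfl

/-- The orthogonal projection onto the boundary `{y_n = 0}`. -/
noncomputable def toBoundary {d : ℕ} (y : EuclideanSpace ℝ (Fin (d + 1))) :
    EuclideanSpace ℝ (Fin (d + 1)) := y - y (Fin.last d) • EuclideanSpace.single (Fin.last d) 1

theorem toBoundary_last {d : ℕ} (y : EuclideanSpace ℝ (Fin (d + 1))) :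
    toBoundary y (Fin.last d) = 0 := by
  simp [toBoundary]

theorem tendsto_toBoundary {d : ℕ} :
    Tendsto (toBoundary (d := d)) (𝓝 0) (𝓝 0) := by
  have : Continuous (toBoundary (d := d)) := by unfold toBoundary; fun_prop
  simpa [toBoundary] using this.tendsto 0

/-- A function whose normal derivative vanishes near `0` is determined by its boundary values. -/
theorem eventually_eq_toBoundary {d : ℕ} {φ : EuclideanSpace ℝ (Fin (d + 1)) → ℝ}
    (hd : ∀ᶠ y in 𝓝 0, DifferentiableAt ℝ φ y)
    (h0 : ∀ᶠ y in 𝓝 0, partialDeriv (Fin.last d) φ y = 0) :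
    ∀ᶠ y in 𝓝 0, φ y = φ (toBoundary y) := by
  obtain ⟨ε, hε, hb⟩ := Metric.eventually_nhds_iff_ball.1 (hd.and h0)
  filter_upwards [Metric.ball_mem_nhds (0 : EuclideanSpace ℝ (Fin (d + 1))) (half_pos hε)] with y hy
  rw [mem_ball_zero_iff] at hy
  set e : EuclideanSpace ℝ (Fin (d + 1)) := EuclideanSpace.single (Fin.last d) 1 with he
  set c : ℝ → EuclideanSpace ℝ (Fin (d + 1)) := fun s => y - s • (y (Fin.last d) • e) with hc
  have hyn : ‖y (Fin.last d) • e‖ ≤ ‖y‖ := by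
    rw [norm_smul, he, PiLp.norm_single, norm_one, mul_one]
    exact PiLp.norm_apply_le y _
  have hcm : ∀ s ∈ Set.Icc (0 : ℝ) 1, c s ∈ Metric.ball (0 : EuclideanSpace ℝ (Fin (d + 1))) ε := by
    intro s hs
    rw [mem_ball_zero_iff]
    calc ‖c s‖ ≤ ‖y‖ + ‖s • (y (Fin.last d) • e)‖ := norm_sub_le _ _
      _ ≤ ‖y‖ + 1 * ‖y‖ := by
        rw [norm_smul, Real.norm_of_nonneg hs.1]
        gcongr
        exact hs.2
      _ < ε := by linarith
  have hder : ∀ s ∈ Set.Icc (0 : ℝ) 1, HasDerivAt (fun s => φ (c s)) 0 s := by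
    intro s hs
    obtain ⟨h1, h2⟩ := hb _ (hcm s hs)
    have hc' : HasDerivAt c (-((1 : ℝ) • (y (Fin.last d) • e))) s :=
      ((hasDerivAt_id s).smul_const _).const_sub y
    have h3 := h1.hasFDerivAt.comp_hasDerivAt s hc'
    rw [map_neg, one_smul, map_smul] at h3
    change fderiv ℝ φ (c s) e = 0 at h2
    rwa [h2, smul_zero, neg_zero] at h3
  have h := constant_of_has_deriv_right_zero (f := fun s => φ (c s)) (a := 0) (b := 1)
    (fun s hs => (hder s hs).continuousAt.continuousWithinAt)
    (fun s hs => (hder s (Set.Ico_subset_Icc_self hs)).hasDerivWithinAt) 1 (by simp)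
  simp only [hc, one_smul, zero_smul, sub_zero] at h
  exact h.symm

end Calculus

section Residual

variable {d m : ℕ}

/-- The pair `(u, ∇u)` at a point, as one vector. -/
noncomputable def jetAt (u : Fin m → EuclideanSpace ℝ (Fin (d + 1)) → ℝ)
    (y : EuclideanSpace ℝ (Fin (d + 1))) : Fin m ⊕ Fin m × Fin (d + 1) → ℝ :=
  Sum.elim (fun i => u i y) fun ik => partialDeriv ik.2 (u ik.1) y

/-- The difference of the two sides of the system. -/
noncomputable def residual (γ : Fin m → ℝ)
    (a : Fin m → Fin (d + 1) → Fin (d + 1) → (Fin m ⊕ Fin m × Fin (d + 1) → ℝ) → ℝ)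
    (G : Fin m → (Fin m ⊕ Fin m × Fin (d + 1) → ℝ) → ℝ)
    (u : Fin m → EuclideanSpace ℝ (Fin (d + 1)) → ℝ) (y : EuclideanSpace ℝ (Fin (d + 1)))
    (j : Fin m) : ℝ :=
  y (Fin.last d) * partialDeriv (Fin.last d) (partialDeriv (Fin.last d) (u j)) y
    + γ j * partialDeriv (Fin.last d) (u j) y
    - (y (Fin.last d) * (∑ k, ∑ l, a j k l (jetAt u y) * partialDeriv k (partialDeriv l (u j)) y)
      + G j (jetAt u y))

open WAlg

variable {τ : ℝ} {hτ : 0 < τ}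

/-- The weighted algebra of functions near `0 ∈ ℝ^{d+1}`. -/
abbrev Alg (d : ℕ) (τ : ℝ) (hτ : 0 < τ) : Type := WAlg (multiWeight (Fin.last d) τ hτ)

/-- The data of the fixed point equation for the system: the concrete operators together with given
extensions `Fa`, `Fg` of the coefficients to the algebra. -/
noncomputable def systemData (hτ1 : τ ≤ 1) (γ : Fin m → ℝ) (hγ : ∀ j, 0 ≤ γ j)
    (Fa : Fin m → Fin (d + 1) → Fin (d + 1) → (Fin m ⊕ Fin m × Fin (d + 1) → Alg d τ hτ) → Alg d τ hτ)
    (Fg : Fin m → Fin m ⊕ Fin m × Fin (d + 1) → (Fin m ⊕ Fin m × Fin (d + 1) → Alg d τ hτ) →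
      Alg d τ hτ) : FuchsData (Alg d τ hτ) (Fin m) (Fin (d + 1)) where
  o := Fin.last d
  I := intL hτ1
  R := derivInt
  H := meanL _ (Fin.last d)
  L j := fuchsInv _ (Fin.last d) (γ j) (hγ j)
  a := Fa
  g := Fg

theorem partialDeriv_of_eventually_eq_ev (hτ1 : τ ≤ 1) {r s : ℝ}
    {f c : EuclideanSpace ℝ (Fin (d + 1)) → ℝ} {y : EuclideanSpace ℝ (Fin (d + 1))}
    (hy : y ∈ evBall (Fin (d + 1)) τ) (A : Alg d τ hτ) (hc : DifferentiableAt ℝ c (r • y))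
    (h : ∀ᶠ z in 𝓝 y, f (r • z) = c (r • z) + s * ev _ z (intL hτ1 A)) (k : Fin (d + 1)) :
    r * partialDeriv k f (r • y) = r * partialDeriv k c (r • y) + s * ev _ y (derivInt k A) := by
  have hev := (analyticAt_ev_apply hτ1 hy (intL hτ1 A)).differentiableAt
  have hcr : DifferentiableAt ℝ (fun z => c (r • z)) y :=
    DifferentiableAt.comp y hc (by fun_prop)
  rw [← partialDeriv_comp_smul, partialDeriv_congr k h, partialDeriv_add k hcr (hev.const_mul s),
    partialDeriv_comp_smul, partialDeriv_const_mul k s hev, partialDeriv_ev_intL hτ1 hy]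

/-- A background function `b` on the ball of radius proportional to `r`, encoded in the algebra: the
parameters of the fixed point equation represent the rescalings of `b`, `∇b` and `r ∇²b`. -/
structure Represents (r : ℝ) (b : Fin m → EuclideanSpace ℝ (Fin (d + 1)) → ℝ)
    (Z : Fin m ⊕ Fin m × Fin (d + 1) → Alg d τ hτ)
    (h : Fin m → Fin (d + 1) → Fin (d + 1) → Alg d τ hτ) : Prop where
  jet : ∀ z, ∀ y ∈ evBall (Fin (d + 1)) τ, ev _ y (Z z) = jetAt b (r • y) z
  hess : ∀ i k l, ∀ y ∈ evBall (Fin (d + 1)) τ,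
    ev _ y (h i k l) = r * partialDeriv k (partialDeriv l (b i)) (r • y)

/-- The extensions `Fa`, `Fg` represent the coefficients `a` and the partial derivatives of `G` on
the ball of radius `ε`. -/
structure Extends
    (a : Fin m → Fin (d + 1) → Fin (d + 1) → (Fin m ⊕ Fin m × Fin (d + 1) → ℝ) → ℝ)
    (G : Fin m → (Fin m ⊕ Fin m × Fin (d + 1) → ℝ) → ℝ)
    (Fa : Fin m → Fin (d + 1) → Fin (d + 1) → (Fin m ⊕ Fin m × Fin (d + 1) → Alg d τ hτ) → Alg d τ hτ)
    (Fg : Fin m → Fin m ⊕ Fin m × Fin (d + 1) → (Fin m ⊕ Fin m × Fin (d + 1) → Alg d τ hτ) →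
      Alg d τ hτ) (ε : ℝ) : Prop where
  coeff : ∀ j k l Z, ‖Z‖ < ε → ∀ y ∈ evBall (Fin (d + 1)) τ,
    ev _ y (Fa j k l Z) = a j k l fun z => ev _ y (Z z)
  lower : ∀ j z Z, ‖Z‖ < ε → ∀ y ∈ evBall (Fin (d + 1)) τ,
    ev _ y (Fg j z Z) = fderiv ℝ (G j) (fun z => ev _ y (Z z)) (Pi.single z 1)
  diff : ∀ j x, ‖x‖ < ε → DifferentiableAt ℝ (G j) x

variable {hτ1 : τ ≤ 1} {γ : Fin m → ℝ} {hγ : ∀ j, 0 ≤ γ j}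
  {a : Fin m → Fin (d + 1) → Fin (d + 1) → (Fin m ⊕ Fin m × Fin (d + 1) → ℝ) → ℝ}
  {G : Fin m → (Fin m ⊕ Fin m × Fin (d + 1) → ℝ) → ℝ}
  {Fa : Fin m → Fin (d + 1) → Fin (d + 1) → (Fin m ⊕ Fin m × Fin (d + 1) → Alg d τ hτ) → Alg d τ hτ}
  {Fg : Fin m → Fin m ⊕ Fin m × Fin (d + 1) → (Fin m ⊕ Fin m × Fin (d + 1) → Alg d τ hτ) →
      Alg d τ hτ} {ε r : ℝ} {u b : Fin m → EuclideanSpace ℝ (Fin (d + 1)) → ℝ}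
  {Z : Fin m ⊕ Fin m × Fin (d + 1) → Alg d τ hτ}
  {h : Fin m → Fin (d + 1) → Fin (d + 1) → Alg d τ hτ} {U : Fin m → Alg d τ hτ}

theorem Represents.eventually_jet (hrep : Represents r b Z h) (hr : 0 < r)
    (hb : ∀ i, AnalyticAt ℝ (b i) 0)
    (hu : ∀ i, ∀ᶠ y in 𝓝 0, u i (r • y) = b i (r • y) + r * ev _ y (intL hτ1 (intL hτ1 (U i)))) :
    ∀ᶠ y in 𝓝 0, ∀ z, jetAt u (r • y) z
      = ev _ y ((systemData hτ1 γ hγ Fa Fg).jet ((Z, h, r), U) z) := by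
  have hball : ∀ᶠ y in 𝓝 0, y ∈ evBall (Fin (d + 1)) τ :=
    Metric.ball_mem_nhds _ (evalRadius_pos hτ)
  have hsm : Tendsto (fun y : EuclideanSpace ℝ (Fin (d + 1)) => r • y) (𝓝 0) (𝓝 0) := by
    simpa using (continuous_const_smul r).tendsto (0 : EuclideanSpace ℝ (Fin (d + 1)))
  have hbd : ∀ᶠ y in 𝓝 0, ∀ i, DifferentiableAt ℝ (b i) (r • y) := eventually_all.2 fun i =>
    hsm.eventually ((hb i).eventually_analyticAt.mono fun _ hz => hz.differentiableAt)
  filter_upwards [hball, hbd, (eventually_all.2 hu).eventually_nhds] with y hy hby huy z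
  rcases z with i | ⟨i, k⟩
  · have := huy.self_of_nhds i
    simp only [jetAt, FuchsData.jet, Sum.elim_inl, map_add, map_smul, smul_eq_mul, systemData]
    rw [this, hrep.jet _ y hy]
    rfl
  · have := partialDeriv_of_eventually_eq_ev hτ1 hy (intL hτ1 (U i)) (hby i)
      (huy.mono fun z hz => hz i) k
    simp only [jetAt, FuchsData.jet, Sum.elim_inr, map_add, systemData]
    rw [← derivInt_intL, hrep.jet _ y hy]
    rw [← mul_add] at this
    exact mul_left_cancel₀ hr.ne' this

theorem Represents.eventually_hess (hrep : Represents r b Z h) (hr : 0 < r)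
    (hb : ∀ i, AnalyticAt ℝ (b i) 0)
    (hu : ∀ i, ∀ᶠ y in 𝓝 0, u i (r • y) = b i (r • y) + r * ev _ y (intL hτ1 (intL hτ1 (U i)))) :
    ∀ᶠ y in 𝓝 0, ∀ i k l, r * partialDeriv k (partialDeriv l (u i)) (r • y)
      = ev _ y ((systemData hτ1 γ hγ Fa Fg).hess ((Z, h, r), U) i k l) := by
  have hball : ∀ᶠ y in 𝓝 0, y ∈ evBall (Fin (d + 1)) τ :=
    Metric.ball_mem_nhds _ (evalRadius_pos hτ)
  have hsm : Tendsto (fun y : EuclideanSpace ℝ (Fin (d + 1)) => r • y) (𝓝 0) (𝓝 0) := by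
    simpa using (continuous_const_smul r).tendsto (0 : EuclideanSpace ℝ (Fin (d + 1)))
  have hbd : ∀ᶠ y in 𝓝 0, ∀ i l, DifferentiableAt ℝ (partialDeriv l (b i)) (r • y) :=
    eventually_all.2 fun i => eventually_all.2 fun l => hsm.eventually
      (((hb i).partialDeriv l).eventually_analyticAt.mono fun _ hz => hz.differentiableAt)
  have hjet := hrep.eventually_jet (hτ1 := hτ1) (γ := γ) (hγ := hγ) (Fa := Fa) (Fg := Fg) hr hb hu
  filter_upwards [hball, hbd, (hjet.and hball).eventually_nhds] with y hy hby hjy i k l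
  have := partialDeriv_of_eventually_eq_ev (f := partialDeriv l (u i)) (s := 1) hτ1 hy
    (derivInt l (U i)) (hby i l) (by
      filter_upwards [hjy] with z hz
      have h1 := hz.1 (.inr (i, l))
      simp only [jetAt, FuchsData.jet, Sum.elim_inr, map_add, systemData] at h1
      rw [h1, hrep.jet _ z hz.2, one_mul]
      rfl) k
  simp only [FuchsData.hess, map_add, systemData]
  rw [hrep.hess _ _ _ y hy, this, one_mul]

theorem Represents.ev_jet_of_normal_eq_zero (hrep : Represents r b Z h)
    {y : EuclideanSpace ℝ (Fin (d + 1))} (hy : y ∈ evBall (Fin (d + 1)) τ)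
    (h0 : y (Fin.last d) = 0) (z : Fin m ⊕ Fin m × Fin (d + 1)) :
    ev _ y ((systemData hτ1 γ hγ Fa Fg).jet ((Z, h, r), U) z) = jetAt b (r • y) z := by
  rw [← hrep.jet z _ hy]
  rcases z with i | ik <;>
  simp [FuchsData.jet, systemData, ev_intL_of_normal_eq_zero hτ1 hy h0]

/-- The residual of the system, rescaled, is `y_n` times an element of the algebra, which vanishes
precisely at the fixed points of the associated map. -/
theorem Represents.eventually_residual (hrep : Represents r b Z h) (hr : 0 < r)
    (hext : Extends a G Fa Fg ε)
    (hε : ‖(systemData hτ1 γ hγ Fa Fg).jet ((Z, h, r), U)‖ < ε)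
    (hb : ∀ i, AnalyticAt ℝ (b i) 0)
    (hbnn : ∀ i, ∀ᶠ y in 𝓝 0, partialDeriv (Fin.last d) (partialDeriv (Fin.last d) (b i)) y = 0)
    (hbG : ∀ᶠ y in 𝓝 0, y (Fin.last d) = 0 → ∀ j,
      γ j * partialDeriv (Fin.last d) (b j) y = G j (jetAt b y))
    (hu : ∀ i, ∀ᶠ y in 𝓝 0, u i (r • y) = b i (r • y) + r * ev _ y (intL hτ1 (intL hτ1 (U i)))) :
    ∀ᶠ y in 𝓝 0, ∀ j, residual γ a G u (r • y) j = y (Fin.last d) *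
      ev _ y (U j + γ j • meanL _ (Fin.last d) (U j)
        - ((systemData hτ1 γ hγ Fa Fg).second ((Z, h, r), U) j
          + meanL _ (Fin.last d) ((systemData hτ1 γ hγ Fa Fg).lower ((Z, h, r), U) j))) := by
  set D := systemData hτ1 γ hγ Fa Fg with hD
  set x : FuchsData.Params (Alg d τ hτ) (Fin m) (Fin (d + 1)) × (Fin m → Alg d τ hτ) :=
    ((Z, h, r), U) with hx
  have hball : ∀ᶠ y in 𝓝 0, y ∈ evBall (Fin (d + 1)) τ :=
    Metric.ball_mem_nhds _ (evalRadius_pos hτ)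
  have hsm : Tendsto (fun y : EuclideanSpace ℝ (Fin (d + 1)) => r • y) (𝓝 0) (𝓝 0) := by
    simpa using (continuous_const_smul r).tendsto (0 : EuclideanSpace ℝ (Fin (d + 1)))
  have hjet := hrep.eventually_jet (hτ1 := hτ1) (γ := γ) (hγ := hγ) (Fa := Fa) (Fg := Fg) hr hb hu
  have hhess := hrep.eventually_hess (hτ1 := hτ1) (γ := γ) (hγ := hγ) (Fa := Fa) (Fg := Fg) hr hb hu
  have hnorm : ∀ y ∈ evBall (Fin (d + 1)) τ, ‖fun z => ev _ y (D.jet x z)‖ < ε := fun y hy =>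
    lt_of_le_of_lt ((pi_norm_le_iff_of_nonneg (norm_nonneg _)).2 fun z =>
      (abs_ev_le hτ1 hy _).trans (norm_le_pi_norm _ z)) hε
  -- the normal derivative of the jet
  have hjn : ∀ᶠ y in 𝓝 0, ∀ z, partialDeriv (Fin.last d) (fun w => ev _ w (D.jet x z)) y
      = ev _ y (D.jetNormal x z) := by
    filter_upwards [hjet.eventually_nhds, hhess] with y hj hh z
    rw [partialDeriv_congr _ ((hj.mono fun w hw => (hw z).symm) :
      (fun w => ev _ w (D.jet x z)) =ᶠ[𝓝 y] fun w => jetAt u (r • w) z)]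
    rcases z with i | ⟨i, k⟩
    · have h1 := hj.self_of_nhds (.inr (i, Fin.last d))
      simp only [FuchsData.jetNormal, Sum.elim_inl, map_smul, smul_eq_mul]
      refine (partialDeriv_comp_smul (f := u i) _ r).trans ?_
      exact congrArg (r * ·) h1
    · refine (partialDeriv_comp_smul (f := partialDeriv k (u i)) _ r).trans ?_
      exact hh i (Fin.last d) k
  -- the lower order term is determined by its boundary values and its normal derivative
  have hψ : ∀ j, ∀ᶠ y in 𝓝 0, G j (fun z => ev _ y (D.jet x z)) - ev _ y (intL hτ1 (D.lower x j))
      = G j (fun z => ev _ (toBoundary y) (D.jet x z))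
        - ev _ (toBoundary y) (intL hτ1 (D.lower x j)) := by
    intro j
    have hGd : ∀ y ∈ evBall (Fin (d + 1)) τ,
        DifferentiableAt ℝ (fun w => G j fun z => ev _ w (D.jet x z)) y := fun y hy =>
      DifferentiableAt.comp y (hext.diff j _ (hnorm y hy))
        (differentiableAt_pi.2 fun z => (analyticAt_ev_apply hτ1 hy _).differentiableAt)
    refine eventually_eq_toBoundary (φ := fun y => G j (fun z => ev _ y (D.jet x z))
      - ev _ y (intL hτ1 (D.lower x j))) ?_ ?_
    · filter_upwards [hball] with y hy
      exact (hGd y hy).sub (analyticAt_ev_apply hτ1 hy _).differentiableAt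
    · filter_upwards [hball, hjn] with y hy hjy
      rw [partialDeriv_sub _ (hGd y hy) (analyticAt_ev_apply hτ1 hy _).differentiableAt,
        partialDeriv_comp (ζ := fun w z => ev _ w (D.jet x z)) _ (hext.diff j _ (hnorm y hy))
          (fun z => (analyticAt_ev_apply hτ1 hy _).differentiableAt),
        partialDeriv_ev_intL hτ1 hy, derivInt_normal, sub_eq_zero]
      simp only [FuchsData.lower, ContinuousLinearMap.id_apply, map_sum, ev_mul hτ1 hy, hjy]
      refine Finset.sum_congr rfl fun z _ => ?_
      congr 1
      exact (hext.lower j z _ hε y hy).symm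
  have hbn : ∀ j, ∀ᶠ y in 𝓝 0, partialDeriv (Fin.last d) (b j) y
      = partialDeriv (Fin.last d) (b j) (toBoundary y) := fun j =>
    eventually_eq_toBoundary (((hb j).partialDeriv _).eventually_analyticAt.mono
      fun _ hz => hz.differentiableAt) (hbnn j)
  have htb : ∀ y : EuclideanSpace ℝ (Fin (d + 1)), toBoundary (r • y) = r • toBoundary y := by
    intro y; simp [toBoundary, smul_sub, smul_smul]
  filter_upwards [hball, tendsto_toBoundary.eventually hball, hjet, hhess, eventually_all.2 hψ,
    hsm.eventually (eventually_all.2 hbn), hsm.eventually (tendsto_toBoundary.eventually hbG),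
    hsm.eventually (eventually_all.2 hbnn)] with y hy hty hjy hhy hψy hbny hbGy hbnny j
  -- the terms of the residual: `e3` lower order, `e4` and `e5` normal, `e6` and `e7` second order
  have e1 : jetAt u (r • y) = fun z => ev _ y (D.jet x z) := funext hjy
  have e2 : (fun z => ev _ (toBoundary y) (D.jet x z)) = jetAt b (toBoundary (r • y)) := by
    funext z
    rw [htb]
    exact hrep.ev_jet_of_normal_eq_zero hty (toBoundary_last y) z
  have e3 : G j (jetAt u (r • y)) = γ j * partialDeriv (Fin.last d) (b j) (r • y)
      + y (Fin.last d) * ev _ y (meanL _ (Fin.last d) (D.lower x j)) := by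
    have := hψy j
    rw [e2, ev_intL_of_normal_eq_zero hτ1 hty (toBoundary_last y), sub_zero,
      ← hbGy (toBoundary_last _) j, ← hbny j, ← ev_meanL hτ1 hy] at this
    rw [e1]
    linarith
  have e4 : partialDeriv (Fin.last d) (u j) (r • y) = partialDeriv (Fin.last d) (b j) (r • y)
      + y (Fin.last d) * ev _ y (meanL _ (Fin.last d) (U j)) := by
    have h1 := hjy (.inr (j, Fin.last d))
    simp only [jetAt, FuchsData.jet, Sum.elim_inr, map_add, systemData, derivInt_normal] at h1
    rw [h1, hrep.jet _ y hy, ev_meanL hτ1 hy]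
    rfl
  have e5 : r * partialDeriv (Fin.last d) (partialDeriv (Fin.last d) (u j)) (r • y)
      = ev _ y (U j) := by
    rw [hhy j]
    simp only [FuchsData.hess, map_add, systemData, derivInt_normal]
    rw [hrep.hess _ _ _ y hy, hbnny j, mul_zero, zero_add]
    rfl
  have e6 : ∑ k, ∑ l, a j k l (jetAt u (r • y)) *
        (r * partialDeriv k (partialDeriv l (u j)) (r • y)) = ev _ y (D.second x j) := by
    simp only [FuchsData.second, map_sum, ev_mul hτ1 hy, hhy, e1]
    refine Finset.sum_congr rfl fun k _ => Finset.sum_congr rfl fun l _ => ?_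
    congr 1
    exact (hext.coeff j k l _ hε y hy).symm
  have e7 : r * (∑ k, ∑ l, a j k l (jetAt u (r • y)) * partialDeriv k (partialDeriv l (u j)) (r • y))
      = ev _ y (D.second x j) := by
    rw [← e6]
    simp only [Finset.mul_sum]
    exact Finset.sum_congr rfl fun k _ => Finset.sum_congr rfl fun l _ => by ring
  rw [residual, e3, e4]
  simp only [map_add, map_sub, map_smul, smul_eq_mul, PiLp.smul_apply]
  linear_combination y (Fin.last d) * e5 - y (Fin.last d) * e7

end Residual

end DegenerateSystem

/-! ### The boundary equation and the background function -/

namespace DegenerateSystem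

variable {d m : ℕ}

/-- The map whose inversion solves the boundary equation `γⱼ qⱼ = Gⱼ(s, p', q)` for the normal
derivatives `q`: it keeps the arguments `s`, `p'` and replaces `qⱼ` by `γⱼ qⱼ - Gⱼ(s, p', q)`. -/
noncomputable def boundaryMap (γ : Fin m → ℝ)
    (G : Fin m → (Fin m ⊕ Fin m × Fin (d + 1) → ℝ) → ℝ) (z : Fin m ⊕ Fin m × Fin (d + 1) → ℝ) :
    Fin m ⊕ Fin m × Fin (d + 1) → ℝ :=
  Sum.elim (fun i => z (.inl i)) fun ik =>
    if ik.2 = Fin.last d then γ ik.1 * z (.inr ik) - G ik.1 z else z (.inr ik)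

/-- The analytic inverse function theorem for `boundaryMap`. Its derivative at `0` is block
triangular with diagonal entries `1` and `γⱼ`, since `Gⱼ` has no linear part in the normal
derivatives. -/
theorem exists_boundaryMap_inverse {γ : Fin m → ℝ}
    {G : Fin m → (Fin m ⊕ Fin m × Fin (d + 1) → ℝ) → ℝ} (hγ : ∀ j, 0 < γ j)
    (hG : ∀ j, AnalyticAt ℝ (G j) 0) (hG0 : ∀ j, G j 0 = 0)
    (hGn : ∀ j i, fderiv ℝ (G j) 0 (Pi.single (.inr (i, Fin.last d)) 1) = 0) :
    ∃ Φ : (Fin m ⊕ Fin m × Fin (d + 1) → ℝ) → Fin m ⊕ Fin m × Fin (d + 1) → ℝ,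
      AnalyticAt ℝ Φ 0 ∧ Φ 0 = 0 ∧ (∀ᶠ z in 𝓝 0, boundaryMap γ G (Φ z) = z) ∧
      ∀ᶠ z in 𝓝 0, Φ (boundaryMap γ G z) = z := by
  have hz0 : boundaryMap γ G 0 = 0 := by
    funext z
    rcases z with i | ⟨i, k⟩ <;> simp [boundaryMap, hG0]
  have han : AnalyticAt ℝ (boundaryMap γ G) 0 := by
    have hp : ∀ s, AnalyticAt ℝ (fun z : Fin m ⊕ Fin m × Fin (d + 1) → ℝ => z s) 0 := fun s =>
      (ContinuousLinearMap.proj (R := ℝ) (φ := fun _ => ℝ) s).analyticAt 0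
    refine AnalyticAt.pi fun s => ?_
    rcases s with i | ⟨i, k⟩
    · exact hp _
    · simp only [boundaryMap, Sum.elim_inr]
      split_ifs
      · exact (analyticAt_const.mul (hp _)).sub (hG i)
      · exact hp _
  have hstrict := han.hasStrictFDerivAt
  set L := fderiv ℝ (boundaryMap γ G) 0 with hL
  have hcomp : ∀ z s, L z s = fderiv ℝ (fun y => boundaryMap γ G y s) 0 z := by
    intro z s
    have := (hasFDerivAt_pi'.1 han.differentiableAt.hasFDerivAt s).fderiv
    rw [this]
    rfl
  have hinj : Function.Injective L := by
    refine (injective_iff_map_eq_zero L).2 fun z hz => ?_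
    have hproj : ∀ s z, fderiv ℝ (fun y : Fin m ⊕ Fin m × Fin (d + 1) → ℝ => y s) 0 z = z s :=
      fun s z => by
        rw [(hasFDerivAt_apply (𝕜 := ℝ) s (0 : Fin m ⊕ Fin m × Fin (d + 1) → ℝ)).fderiv]
        rfl
    have h1 : ∀ i, z (.inl i) = 0 := fun i => by
      have := hcomp z (.inl i)
      rw [hz] at this
      exact ((hproj (.inl i) z).symm.trans this.symm)
    have h2 : ∀ i k, k ≠ Fin.last d → z (.inr (i, k)) = 0 := fun i k hk => by
      have := hcomp z (.inr (i, k))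
      simp only [boundaryMap, Sum.elim_inr, if_neg hk] at this
      rw [hz, hproj] at this
      exact this.symm
    have h3 : ∀ j, fderiv ℝ (G j) 0 z = 0 := fun j => by
      rw [pi_eq_sum_univ' z, map_sum]
      refine Finset.sum_eq_zero fun s _ => ?_
      rw [map_smul]
      rcases s with i | ⟨i, k⟩
      · rw [h1, zero_smul]
      · by_cases hk : k = Fin.last d
        · rw [hk, hGn, smul_zero]
        · rw [h2 i k hk, zero_smul]
    funext s
    rcases s with i | ⟨i, k⟩
    · exact h1 i
    · by_cases hk : k = Fin.last d
      · have := hcomp z (.inr (i, k))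
        simp only [boundaryMap, Sum.elim_inr, if_pos hk] at this
        rw [hz, fderiv_fun_sub ((differentiableAt_apply _ _).const_mul _) (hG i).differentiableAt,
          fderiv_const_mul (differentiableAt_apply _ _), _root_.sub_apply,
          h3 i, sub_zero, _root_.smul_apply, hproj, smul_eq_mul] at this
        exact (mul_eq_zero.1 this.symm).resolve_left (hγ i).ne'
      · exact h2 i k hk
  set e : (Fin m ⊕ Fin m × Fin (d + 1) → ℝ) ≃L[ℝ] (Fin m ⊕ Fin m × Fin (d + 1) → ℝ) :=
    (LinearEquiv.ofInjectiveEndo L.toLinearMap hinj).toContinuousLinearEquiv with he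
  have heL : (e : (Fin m ⊕ Fin m × Fin (d + 1) → ℝ) →L[ℝ] _) = L := by ext; rfl
  have hs : HasStrictFDerivAt (boundaryMap γ G)
    (e : (Fin m ⊕ Fin m × Fin (d + 1) → ℝ) →L[ℝ] _) 0 := by rw [heL]; exact hstrict
  refine ⟨hs.localInverse _ _ _, ?_, ?_, ?_, ?_⟩
  · have := (hs.toOpenPartialHomeomorph _).analyticAt_symm' (i := e)
      hs.mem_toOpenPartialHomeomorph_source han (heL.symm ▸ rfl)
    rw [HasStrictFDerivAt.toOpenPartialHomeomorph_coe, hz0] at this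
    exact this
  · have := hs.localInverse_apply_image
    rwa [hz0] at this
  · have := hs.eventually_right_inverse
    rwa [hz0] at this
  · exact hs.eventually_left_inverse

/-- The tangential variables `y'` of a point. -/
noncomputable def tangential (d : ℕ) :
    EuclideanSpace ℝ (Fin (d + 1)) →L[ℝ] EuclideanSpace ℝ (Fin d) :=
  (PiLp.continuousLinearEquiv 2 ℝ fun _ : Fin d => ℝ).symm.toContinuousLinearMap.comp
    (ContinuousLinearMap.pi fun k => EuclideanSpace.proj k.castSucc)

theorem tangential_apply (y : EuclideanSpace ℝ (Fin (d + 1))) (k : Fin d) :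
    tangential d y k = y k.castSucc := rfl

theorem tangential_single_last (c : ℝ) :
    tangential d (EuclideanSpace.single (Fin.last d) c) = 0 := by
  ext k
  rw [tangential_apply]
  simp [Fin.castSucc_ne_last]

theorem tangential_single_castSucc (k : Fin d) (c : ℝ) :
    tangential d (EuclideanSpace.single k.castSucc c) = EuclideanSpace.single k c := by
  ext l
  rw [tangential_apply]
  simp

theorem boundaryPoint_tangential {y : EuclideanSpace ℝ (Fin (d + 1))} (hy : y (Fin.last d) = 0) :
    boundaryPoint (tangential d y) = y := by
  ext k
  refine Fin.lastCases ?_ (fun k => ?_) k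
  · simp [boundaryPoint, hy]
  · simp [boundaryPoint, tangential_apply]

theorem tangential_boundaryPoint (x : EuclideanSpace ℝ (Fin d)) :
    tangential d (boundaryPoint x) = x := by
  ext k
  simp [boundaryPoint, tangential_apply]

theorem boundaryPoint_last (x : EuclideanSpace ℝ (Fin d)) :
    boundaryPoint x (Fin.last d) = 0 := by simp [boundaryPoint]

theorem tendsto_tangential : Tendsto (tangential d) (𝓝 0) (𝓝 0) := by
  simpa using (tangential d).continuous.tendsto 0

theorem tendsto_boundaryPoint : Tendsto (boundaryPoint (d := d)) (𝓝 0) (𝓝 0) := by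
  have h0 : boundaryPoint (0 : EuclideanSpace ℝ (Fin d)) = 0 := by
    have := boundaryPoint_tangential (d := d) (y := 0) rfl
    rwa [map_zero] at this
  have : Continuous (boundaryPoint (d := d)) := by
    unfold boundaryPoint
    refine (PiLp.continuous_toLp 2 _).comp (continuous_pi fun k => ?_)
    refine Fin.lastCases ?_ (fun k => ?_) k
    · simpa using continuous_const
    · simp only [Fin.snoc_castSucc]; fun_prop
  simpa [h0] using this.tendsto 0

/-- The boundary data `(v₀, ∇'v₀)`, with zeros in place of the normal derivatives. -/
noncomputable def boundaryData (v₀ : EuclideanSpace ℝ (Fin d) → EuclideanSpace ℝ (Fin m))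
    (x : EuclideanSpace ℝ (Fin d)) : Fin m ⊕ Fin m × Fin (d + 1) → ℝ :=
  Sum.elim (fun i => v₀ x i) fun ik =>
    Fin.lastCases (motive := fun _ => ℝ) 0
      (fun k => fderiv ℝ v₀ x (EuclideanSpace.single k 1) ik.1) ik.2

theorem analyticAt_boundaryData {v₀ : EuclideanSpace ℝ (Fin d) → EuclideanSpace ℝ (Fin m)}
    (hv₀ : AnalyticAt ℝ v₀ 0) : AnalyticAt ℝ (boundaryData v₀) 0 := by
  refine AnalyticAt.pi fun s => ?_
  rcases s with i | ⟨i, k⟩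
  · exact ((EuclideanSpace.proj (𝕜 := ℝ) i).analyticAt _).comp hv₀
  · refine Fin.lastCases ?_ (fun k => ?_) k
    · simpa [boundaryData] using analyticAt_const
    · simp only [boundaryData, Sum.elim_inr, Fin.lastCases_castSucc]
      exact (((EuclideanSpace.proj (𝕜 := ℝ) i).comp (ContinuousLinearMap.apply ℝ
        (EuclideanSpace ℝ (Fin m)) (EuclideanSpace.single k (1 : ℝ)))).analyticAt _).comp hv₀.fderiv

theorem norm_boundaryData_le {v₀ : EuclideanSpace ℝ (Fin d) → EuclideanSpace ℝ (Fin m)} {ε : ℝ}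
    (h0 : ‖v₀ 0‖ ≤ ε) (h1 : ‖fderiv ℝ v₀ 0‖ ≤ ε) : ‖boundaryData v₀ 0‖ ≤ ε := by
  have hε : 0 ≤ ε := (norm_nonneg _).trans h0
  refine (pi_norm_le_iff_of_nonneg hε).2 fun s => ?_
  rcases s with i | ⟨i, k⟩
  · exact (PiLp.norm_apply_le (v₀ 0) i).trans h0
  · refine Fin.lastCases ?_ (fun k => ?_) k
    · simpa [boundaryData] using hε
    · simp only [boundaryData, Sum.elim_inr, Fin.lastCases_castSucc]
      refine (PiLp.norm_apply_le (fderiv ℝ v₀ 0 (EuclideanSpace.single k 1)) i).trans ?_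
      refine ((fderiv ℝ v₀ 0).le_opNorm _).trans ?_
      rw [PiLp.norm_single, norm_one, mul_one]
      exact h1

/-- At the boundary, a tangential derivative of a function is the derivative of its trace. -/
theorem partialDeriv_castSucc_of_boundary {f : EuclideanSpace ℝ (Fin (d + 1)) → ℝ}
    {f₀ : EuclideanSpace ℝ (Fin d) → ℝ} {y : EuclideanSpace ℝ (Fin (d + 1))}
    (hy : y (Fin.last d) = 0) (hf : DifferentiableAt ℝ f y)
    (h : ∀ᶠ x in 𝓝 (tangential d y), f (boundaryPoint x) = f₀ x)
    (hf₀ : DifferentiableAt ℝ f₀ (tangential d y)) (k : Fin d) :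
    partialDeriv k.castSucc f y = fderiv ℝ f₀ (tangential d y) (EuclideanSpace.single k 1) := by
  rw [partialDeriv, ← hf.lineDeriv_eq_fderiv, ← hf₀.lineDeriv_eq_fderiv, lineDeriv, lineDeriv]
  refine Filter.EventuallyEq.deriv_eq ?_
  have hc : Tendsto (fun t : ℝ => tangential d y + t • EuclideanSpace.single k (1 : ℝ)) (𝓝 0)
      (𝓝 (tangential d y)) := by
    have : Continuous fun t : ℝ => tangential d y + t • EuclideanSpace.single k (1 : ℝ) := by
      fun_prop
    simpa using this.tendsto 0
  filter_upwards [hc.eventually h] with t ht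
  rw [← ht]
  congr 1
  have h1 : (y + t • EuclideanSpace.single k.castSucc (1 : ℝ)) (Fin.last d) = 0 := by
    simp [hy, (Fin.castSucc_ne_last k).symm]
  rw [← boundaryPoint_tangential h1, map_add, map_smul, tangential_single_castSucc]

section Background

variable {γ : Fin m → ℝ} {G : Fin m → (Fin m ⊕ Fin m × Fin (d + 1) → ℝ) → ℝ}
  {Φ : (Fin m ⊕ Fin m × Fin (d + 1) → ℝ) → Fin m ⊕ Fin m × Fin (d + 1) → ℝ}
  {v₀ : EuclideanSpace ℝ (Fin d) → EuclideanSpace ℝ (Fin m)}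

/-- The background function `v₀(y') + y_n v₁(y')`, where `v₁` is the normal derivative component of
`Φ` at the boundary data of `v₀`. If `Φ` is inverse to `boundaryMap`, then `v₁` solves the boundary
equation. -/
noncomputable def background
    (Φ : (Fin m ⊕ Fin m × Fin (d + 1) → ℝ) → Fin m ⊕ Fin m × Fin (d + 1) → ℝ)
    (v₀ : EuclideanSpace ℝ (Fin d) → EuclideanSpace ℝ (Fin m)) (i : Fin m)
    (y : EuclideanSpace ℝ (Fin (d + 1))) : ℝ :=
  v₀ (tangential d y) i
    + y (Fin.last d) * Φ (boundaryData v₀ (tangential d y)) (.inr (i, Fin.last d))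

theorem analyticAt_normalCoeff (hΦ : AnalyticAt ℝ Φ (boundaryData v₀ 0)) (hv₀ : AnalyticAt ℝ v₀ 0)
    (i : Fin m) : AnalyticAt ℝ (fun x => Φ (boundaryData v₀ x) (.inr (i, Fin.last d))) 0 :=
  ((ContinuousLinearMap.proj (R := ℝ) (φ := fun _ : Fin m ⊕ Fin m × Fin (d + 1) => ℝ)
    (.inr (i, Fin.last d))).analyticAt _).comp
    (hΦ.comp (analyticAt_boundaryData hv₀))

theorem analyticAt_comp_tangential {f : EuclideanSpace ℝ (Fin d) → ℝ} (hf : AnalyticAt ℝ f 0) :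
    AnalyticAt ℝ (fun y => f (tangential d y)) 0 :=
  AnalyticAt.comp (f := tangential d) (x := 0) (by rwa [map_zero]) ((tangential d).analyticAt 0)

theorem analyticAt_background (hΦ : AnalyticAt ℝ Φ (boundaryData v₀ 0))
    (hv₀ : AnalyticAt ℝ v₀ 0) (i : Fin m) : AnalyticAt ℝ (background Φ v₀ i) 0 := by
  have h1 : AnalyticAt ℝ (fun x => v₀ x i) 0 :=
    ((EuclideanSpace.proj (𝕜 := ℝ) i).analyticAt _).comp hv₀
  exact (analyticAt_comp_tangential h1).add
    (((EuclideanSpace.proj (𝕜 := ℝ) (Fin.last d)).analyticAt 0).mul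
      (analyticAt_comp_tangential (analyticAt_normalCoeff hΦ hv₀ i)))

theorem partialDeriv_last_comp_tangential {f : EuclideanSpace ℝ (Fin d) → ℝ}
    {y : EuclideanSpace ℝ (Fin (d + 1))} (hf : DifferentiableAt ℝ f (tangential d y)) :
    partialDeriv (Fin.last d) (fun y => f (tangential d y)) y = 0 := by
  have := (hf.hasFDerivAt.comp y (tangential d).hasFDerivAt).fderiv
  refine (DFunLike.congr_fun this _).trans ?_
  rw [ContinuousLinearMap.comp_apply, tangential_single_last, map_zero]

theorem partialDeriv_last_background (hΦ : AnalyticAt ℝ Φ (boundaryData v₀ 0))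
    (hv₀ : AnalyticAt ℝ v₀ 0) (i : Fin m) :
    ∀ᶠ y in 𝓝 0, partialDeriv (Fin.last d) (background Φ v₀ i) y
      = Φ (boundaryData v₀ (tangential d y)) (.inr (i, Fin.last d)) := by
  have h1 : AnalyticAt ℝ (fun x => v₀ x i) 0 :=
    ((EuclideanSpace.proj (𝕜 := ℝ) i).analyticAt _).comp hv₀
  have h2 := analyticAt_normalCoeff hΦ hv₀ i
  filter_upwards [tendsto_tangential.eventually h1.eventually_analyticAt,
    tendsto_tangential.eventually h2.eventually_analyticAt] with y hy1 hy2
  have hd1 : DifferentiableAt ℝ (fun y => v₀ (tangential d y) i) y :=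
    hy1.differentiableAt.comp y (tangential d).differentiableAt
  have hd2 : DifferentiableAt ℝ
      (fun y => Φ (boundaryData v₀ (tangential d y)) (.inr (i, Fin.last d))) y :=
    hy2.differentiableAt.comp y (tangential d).differentiableAt
  have hd3 : HasFDerivAt (fun y : EuclideanSpace ℝ (Fin (d + 1)) => y (Fin.last d))
      (EuclideanSpace.proj (Fin.last d) : EuclideanSpace ℝ (Fin (d + 1)) →L[ℝ] ℝ) y :=
    (EuclideanSpace.proj (Fin.last d) : EuclideanSpace ℝ (Fin (d + 1)) →L[ℝ] ℝ).hasFDerivAt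
  refine (partialDeriv_add _ hd1 (hd3.differentiableAt.mul hd2)).trans ?_
  rw [partialDeriv_last_comp_tangential hy1.differentiableAt, zero_add, partialDeriv,
    (hd3.mul hd2.hasFDerivAt).fderiv]
  have h4 := partialDeriv_last_comp_tangential hy2.differentiableAt
  rw [partialDeriv] at h4
  simp [h4]

theorem partialDeriv_last_last_background (hΦ : AnalyticAt ℝ Φ (boundaryData v₀ 0))
    (hv₀ : AnalyticAt ℝ v₀ 0) (i : Fin m) :
    ∀ᶠ y in 𝓝 0,
      partialDeriv (Fin.last d) (partialDeriv (Fin.last d) (background Φ v₀ i)) y = 0 := by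
  filter_upwards [(partialDeriv_last_background hΦ hv₀ i).eventually_nhds,
    tendsto_tangential.eventually (analyticAt_normalCoeff hΦ hv₀ i).eventually_analyticAt]
    with y hy1 hy2
  rw [partialDeriv_congr _ hy1, partialDeriv_last_comp_tangential hy2.differentiableAt]

/-- An extension of `v₀` which satisfies the boundary equation has a jet at the boundary that
`boundaryMap` sends to the boundary data of `v₀`. -/
theorem boundaryMap_jetAt {u : Fin m → EuclideanSpace ℝ (Fin (d + 1)) → ℝ}
    (hu : ∀ i, AnalyticAt ℝ (u i) 0) (hv₀ : AnalyticAt ℝ v₀ 0)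
    (hub : ∀ i, ∀ᶠ x in 𝓝 0, u i (boundaryPoint x) = v₀ x i) :
    ∀ᶠ y in 𝓝 0, y (Fin.last d) = 0 →
      (∀ j, γ j * partialDeriv (Fin.last d) (u j) y = G j (jetAt u y)) →
      boundaryMap γ G (jetAt u y) = boundaryData v₀ (tangential d y) := by
  filter_upwards [tendsto_tangential.eventually (eventually_all.2 hub).eventually_nhds,
    tendsto_tangential.eventually hv₀.eventually_analyticAt,
    eventually_all.2 fun i => (hu i).eventually_analyticAt] with y hy1 hy2 hy3 hy0 hyG
  have hbt := boundaryPoint_tangential hy0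
  funext s
  rcases s with i | ⟨i, k⟩
  · have := hy1.self_of_nhds i
    rw [hbt] at this
    exact this
  · refine Fin.lastCases ?_ (fun k => ?_) k
    · simp [boundaryMap, boundaryData, jetAt, hyG i]
    · have h1 : HasFDerivAt (fun x => v₀ x i)
          ((EuclideanSpace.proj (𝕜 := ℝ) i).comp (fderiv ℝ v₀ (tangential d y)))
          (tangential d y) :=
        (EuclideanSpace.proj (𝕜 := ℝ) i).hasFDerivAt.comp _ hy2.differentiableAt.hasFDerivAt
      have := partialDeriv_castSucc_of_boundary hy0 (hy3 i).differentiableAt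
        (hy1.mono fun x hx => hx i) h1.differentiableAt k
      rw [h1.fderiv] at this
      simp only [boundaryMap, boundaryData, jetAt, Sum.elim_inr, Fin.lastCases_castSucc,
        if_neg (Fin.castSucc_ne_last k)]
      exact this

theorem background_boundary (i : Fin m) (x : EuclideanSpace ℝ (Fin d)) :
    background Φ v₀ i (boundaryPoint x) = v₀ x i := by
  rw [background, tangential_boundaryPoint, boundaryPoint_last, zero_mul, add_zero]

/-- The `1`-jet of the background function at the boundary. -/
theorem jetAt_background (hΦ : AnalyticAt ℝ Φ (boundaryData v₀ 0)) (hv₀ : AnalyticAt ℝ v₀ 0)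
    (hΦr : ∀ᶠ z in 𝓝 (boundaryData v₀ 0), boundaryMap γ G (Φ z) = z) :
    ∀ᶠ y in 𝓝 0, y (Fin.last d) = 0 →
      jetAt (background Φ v₀) y = Φ (boundaryData v₀ (tangential d y)) := by
  have hb := analyticAt_background hΦ hv₀
  have hc : Tendsto (fun y => boundaryData v₀ (tangential d y)) (𝓝 0) (𝓝 (boundaryData v₀ 0)) :=
    (analyticAt_boundaryData hv₀).continuousAt.tendsto.comp tendsto_tangential
  -- only the tangential components of `boundaryMap_jetAt` are needed, so the system is irrelevant
  have h := boundaryMap_jetAt (γ := fun _ => 0) (G := fun _ _ => 0) hb hv₀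
    (fun i => .of_forall (background_boundary i))
  filter_upwards [h, hc.eventually hΦr,
    eventually_all.2 (partialDeriv_last_background hΦ hv₀)] with y hy1 hy2 hy3 hy0
  have h1 := hy1 hy0 fun j => by simp
  funext s
  have e1 := congrFun h1 s
  have e2 := congrFun hy2 s
  rcases s with i | ⟨i, k⟩
  · simp only [boundaryMap, Sum.elim_inl] at e1 e2
    rw [e1, e2]
  · by_cases hk : k = Fin.last d
    · subst hk
      exact hy3 i
    · simp only [boundaryMap, Sum.elim_inr, if_neg hk] at e1 e2
      rw [e1, e2]

theorem background_boundary_equation (hΦ : AnalyticAt ℝ Φ (boundaryData v₀ 0))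
    (hv₀ : AnalyticAt ℝ v₀ 0)
    (hΦr : ∀ᶠ z in 𝓝 (boundaryData v₀ 0), boundaryMap γ G (Φ z) = z) :
    ∀ᶠ y in 𝓝 0, y (Fin.last d) = 0 → ∀ j,
      γ j * partialDeriv (Fin.last d) (background Φ v₀ j) y
        = G j (jetAt (background Φ v₀) y) := by
  have hc : Tendsto (fun y => boundaryData v₀ (tangential d y)) (𝓝 0) (𝓝 (boundaryData v₀ 0)) :=
    (analyticAt_boundaryData hv₀).continuousAt.tendsto.comp tendsto_tangential
  filter_upwards [jetAt_background hΦ hv₀ hΦr, hc.eventually hΦr] with y hy1 hy2 hy0 j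
  have h1 := congrFun hy2 (.inr (j, Fin.last d))
  rw [← hy1 hy0] at h1
  simp only [boundaryMap, boundaryData, jetAt, Sum.elim_inr, if_pos, Fin.lastCases_last] at h1
  exact sub_eq_zero.1 h1

end Background

section Representation

open WAlg

variable {τ : ℝ} {hτ : 0 < τ}

/-- A function is recovered from its boundary values, its normal derivative at the boundary and its
second normal derivative. -/
theorem eventually_eq_add_ev_intL_intL (hτ1 : τ ≤ 1) {r : ℝ}
    {f b : EuclideanSpace ℝ (Fin (d + 1)) → ℝ} {A : Alg d τ hτ} (hf : AnalyticAt ℝ f 0)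
    (hb : AnalyticAt ℝ b 0)
    (hbnn : ∀ᶠ y in 𝓝 0, partialDeriv (Fin.last d) (partialDeriv (Fin.last d) b) y = 0)
    (hfb : ∀ᶠ y in 𝓝 0, y (Fin.last d) = 0 →
      f y = b y ∧ partialDeriv (Fin.last d) f y = partialDeriv (Fin.last d) b y)
    (hA : ∀ y ∈ evBall (Fin (d + 1)) τ,
      ev _ y A = r * partialDeriv (Fin.last d) (partialDeriv (Fin.last d) f) (r • y)) :
    ∀ᶠ y in 𝓝 0, f (r • y) = b (r • y) + r * ev _ y (intL hτ1 (intL hτ1 A)) := by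
  have hball : ∀ᶠ y in 𝓝 0, y ∈ evBall (Fin (d + 1)) τ :=
    Metric.ball_mem_nhds _ (evalRadius_pos hτ)
  have hsm : Tendsto (fun y : EuclideanSpace ℝ (Fin (d + 1)) => r • y) (𝓝 0) (𝓝 0) := by
    simpa using (continuous_const_smul r).tendsto (0 : EuclideanSpace ℝ (Fin (d + 1)))
  have hbdry := tendsto_toBoundary.eventually (hsm.eventually hfb)
  have hbr : ∀ y : EuclideanSpace ℝ (Fin (d + 1)), (r • toBoundary y) (Fin.last d) = 0 :=
    fun y => by rw [PiLp.smul_apply, toBoundary_last, smul_zero]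
  have hD : ∀ {F : EuclideanSpace ℝ (Fin (d + 1)) → ℝ}, AnalyticAt ℝ F 0 →
      ∀ᶠ y in 𝓝 0, DifferentiableAt ℝ (fun z => F (r • z)) y := fun hF =>
    (hsm.eventually hF.eventually_analyticAt).mono fun y hy =>
      DifferentiableAt.comp y hy.differentiableAt (by fun_prop)
  have hf1 := hf.partialDeriv (Fin.last d)
  have hb1 := hb.partialDeriv (Fin.last d)
  have h1 : ∀ᶠ y in 𝓝 0, partialDeriv (Fin.last d) f (r • y)
      - partialDeriv (Fin.last d) b (r • y) - ev _ y (intL hτ1 A) = 0 := by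
    have := eventually_eq_toBoundary (φ := fun y => partialDeriv (Fin.last d) f (r • y)
      - partialDeriv (Fin.last d) b (r • y) - ev _ y (intL hτ1 A)) (by
        filter_upwards [hball, hD hf1, hD hb1] with y hy h1 h2
        exact (h1.fun_sub h2).sub (analyticAt_ev_apply hτ1 hy _).differentiableAt) (by
        filter_upwards [hball, hD hf1, hD hb1, hsm.eventually hbnn] with y hy h1 h2 h3
        rw [partialDeriv_sub _ (h1.fun_sub h2) (analyticAt_ev_apply hτ1 hy _).differentiableAt,
          partialDeriv_sub _ h1 h2, partialDeriv_comp_smul, partialDeriv_comp_smul, h3,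
          partialDeriv_ev_intL hτ1 hy, derivInt_normal, ContinuousLinearMap.id_apply, hA y hy]
        ring)
    filter_upwards [this, hbdry, tendsto_toBoundary.eventually hball] with y hy1 hy2 hy3
    rw [hy1, (hy2 (hbr y)).2, ev_intL_of_normal_eq_zero hτ1 hy3 (toBoundary_last y)]
    ring
  have h2 := eventually_eq_toBoundary (φ := fun y => f (r • y) - b (r • y)
      - r * ev _ y (intL hτ1 (intL hτ1 A))) (by
        filter_upwards [hball, hD hf, hD hb] with y hy h1 h2
        exact (h1.fun_sub h2).sub ((analyticAt_ev_apply hτ1 hy _).differentiableAt.const_mul r)) (by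
        filter_upwards [hball, hD hf, hD hb, h1] with y hy h2 h3 h4
        have h5 := (analyticAt_ev_apply hτ1 hy (intL hτ1 (intL hτ1 A))).differentiableAt
        rw [partialDeriv_sub _ (h2.fun_sub h3) (h5.const_mul r), partialDeriv_sub _ h2 h3,
          partialDeriv_comp_smul, partialDeriv_comp_smul, partialDeriv_const_mul _ _ h5,
          partialDeriv_ev_intL hτ1 hy, derivInt_normal, ContinuousLinearMap.id_apply]
        linear_combination r * h4)
  filter_upwards [h2, hbdry, tendsto_toBoundary.eventually hball] with y hy1 hy2 hy3
  rw [(hy2 (hbr y)).1, ev_intL_of_normal_eq_zero hτ1 hy3 (toBoundary_last y)] at hy1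
  linarith

end Representation

end DegenerateSystem

/-! ### Existence and uniqueness for given boundary jets -/

namespace DegenerateSystem

open WAlg

variable {d m : ℕ}

section Prelim

variable {τ : ℝ} {hτ : 0 < τ}

/-- The functional calculus extends all coefficients of the system on a common ball. -/
theorem exists_extends (hτ1 : τ ≤ 1)
    {a : Fin m → Fin (d + 1) → Fin (d + 1) → (Fin m ⊕ Fin m × Fin (d + 1) → ℝ) → ℝ}
    {G : Fin m → (Fin m ⊕ Fin m × Fin (d + 1) → ℝ) → ℝ}
    (ha : ∀ j k l, AnalyticAt ℝ (a j k l) 0) (hG : ∀ j, AnalyticAt ℝ (G j) 0) :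
    ∃ (Fa : Fin m → Fin (d + 1) → Fin (d + 1) → (Fin m ⊕ Fin m × Fin (d + 1) → Alg d τ hτ) →
        Alg d τ hτ)
      (Fg : Fin m → Fin m ⊕ Fin m × Fin (d + 1) → (Fin m ⊕ Fin m × Fin (d + 1) → Alg d τ hτ) →
        Alg d τ hτ) (ε : ℝ), 0 < ε ∧ Extends a G Fa Fg ε ∧
      (∀ j k l, AnalyticAt ℝ (Fa j k l) 0) ∧
      (∀ j k l, Fa j k l 0 = algebraMap ℝ _ (a j k l 0)) ∧
      (∀ j z, AnalyticAt ℝ (Fg j z) 0) ∧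
      ∀ j z, Fg j z 0 = algebraMap ℝ _ (fderiv ℝ (G j) 0 (Pi.single z 1)) := by
  have hg : ∀ j (z : Fin m ⊕ Fin m × Fin (d + 1)),
      AnalyticAt ℝ (fun x => fderiv ℝ (G j) x (Pi.single z 1)) 0 := fun j z =>
    ((ContinuousLinearMap.apply ℝ ℝ (Pi.single z (1 : ℝ) :
      Fin m ⊕ Fin m × Fin (d + 1) → ℝ)).analyticAt _).comp (hG j).fderiv
  choose Fa hFa hFa0 εa hεa hFae using fun j k l =>
    (ha j k l).exists_functional_calculus (B := Alg d τ hτ)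
  choose Fg hFg hFg0 εg hεg hFge using fun j z =>
    (hg j z).exists_functional_calculus (B := Alg d τ hτ)
  have hd : ∀ j, ∃ ε > 0, ∀ x, ‖x‖ < ε → DifferentiableAt ℝ (G j) x := fun j => by
    obtain ⟨ε, hε, hb⟩ := Metric.eventually_nhds_iff_ball.1 (hG j).eventually_analyticAt
    exact ⟨ε, hε, fun x hx => (hb x (mem_ball_zero_iff.2 hx)).differentiableAt⟩
  choose εd hεd hde using hd
  -- a common radius for the finitely many functions involved
  have hlt : ∀ {δ : ℝ}, 0 < δ → ∀ᶠ ε in 𝓝[>] (0 : ℝ), ε < δ := fun hδ =>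
    (eventually_lt_nhds hδ).filter_mono nhdsWithin_le_nhds
  obtain ⟨ε, h1, h2, h3, h4⟩ := ((eventually_all.2 fun j => eventually_all.2 fun k =>
    eventually_all.2 fun l => hlt (hεa j k l)).and ((eventually_all.2 fun j =>
      eventually_all.2 fun z => hlt (hεg j z)).and ((eventually_all.2 fun j => hlt (hεd j)).and
        self_mem_nhdsWithin))).exists
  refine ⟨Fa, Fg, ε, h4, ⟨?_, ?_, ?_⟩, hFa, hFa0, hFg, hFg0⟩
  · intro j k l Z hZ y hy
    exact hFae j k l (evHom hτ1 hy) (abs_ev_le hτ1 hy) Z (hZ.trans (h1 j k l))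
  · intro j z Z hZ y hy
    exact hFge j z (evHom hτ1 hy) (abs_ev_le hτ1 hy) Z (hZ.trans (h2 j z))
  · intro j x hx
    exact hde j x (hx.trans (h3 j))

/-- An analytic background function is represented at all small scales `r`; as `r → 0` its jet tends
to the constant `jetAt b 0` and its Hessian to `0`, because it enters with a factor `r`. -/
theorem exists_represents (hτ1 : τ ≤ 1) {b : Fin m → EuclideanSpace ℝ (Fin (d + 1)) → ℝ}
    (hb : ∀ i, AnalyticAt ℝ (b i) 0) :
    ∃ (Z : ℝ → Fin m ⊕ Fin m × Fin (d + 1) → Alg d τ hτ)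
      (h : ℝ → Fin m → Fin (d + 1) → Fin (d + 1) → Alg d τ hτ),
      Tendsto Z (𝓝 0) (𝓝 fun z => algebraMap ℝ _ (jetAt b 0 z)) ∧ Tendsto h (𝓝 0) (𝓝 0) ∧
      ∀ᶠ r in 𝓝 0, Represents r b (Z r) (h r) := by
  have hj : ∀ z, AnalyticAt ℝ (fun y => jetAt b y z) 0 := by
    rintro (i | ik)
    · exact hb i
    · exact (hb ik.1).partialDeriv ik.2
  choose Z hZ hZe using fun z => exists_rescaling (o := Fin.last d) (hτ := hτ) hτ1 (hj z)
  choose h hh hhe using fun i k l => exists_rescaling (o := Fin.last d) (hτ := hτ) hτ1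
    (((hb i).partialDeriv l).partialDeriv k)
  refine ⟨fun r z => Z z r, fun r i k l => r • h i k l r, tendsto_pi_nhds.2 hZ, ?_, ?_⟩
  · refine tendsto_pi_nhds.2 fun i => tendsto_pi_nhds.2 fun k => tendsto_pi_nhds.2 fun l => ?_
    have := (tendsto_id (x := 𝓝 (0 : ℝ))).smul (hh i k l)
    rw [zero_smul] at this
    exact this
  · filter_upwards [eventually_all.2 hZe, eventually_all.2 fun i => eventually_all.2 fun k =>
      eventually_all.2 (hhe i k)] with r h1 h2
    refine ⟨h1, fun i k l y hy => ?_⟩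
    rw [map_smul, h2 i k l y hy, smul_eq_mul]

/-- The unknown `U = r ∂ₙ² u(r ·)` of the fixed point equation attached to an analytic function `u`
is small when `r` is small. -/
theorem exists_secondNormal (hτ1 : τ ≤ 1) {u : Fin m → EuclideanSpace ℝ (Fin (d + 1)) → ℝ}
    (hu : ∀ i, AnalyticAt ℝ (u i) 0) :
    ∃ U : ℝ → Fin m → Alg d τ hτ, Tendsto U (𝓝 0) (𝓝 0) ∧
      ∀ᶠ r in 𝓝 0, ∀ i, ∀ y ∈ evBall (Fin (d + 1)) τ, ev _ y (U r i)
        = r * partialDeriv (Fin.last d) (partialDeriv (Fin.last d) (u i)) (r • y) := by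
  choose A hA hAe using fun i => exists_rescaling (o := Fin.last d) (hτ := hτ) hτ1
    (((hu i).partialDeriv (Fin.last d)).partialDeriv (Fin.last d))
  refine ⟨fun r i => r • A i r, tendsto_pi_nhds.2 fun i => ?_, ?_⟩
  · have := (tendsto_id (x := 𝓝 (0 : ℝ))).smul (hA i)
    rw [zero_smul] at this
    exact this
  · filter_upwards [eventually_all.2 hAe] with r h1 i y hy
    rw [map_smul, h1 i y hy, smul_eq_mul]

/-- An element of the algebra which vanishes as a function on `y_n > 0` near `0` is zero. -/
theorem eq_zero_of_ev_normal_pos (hτ1 : τ ≤ 1) {A : Alg d τ hτ}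
    (h : ∀ᶠ y in 𝓝 0, 0 < y (Fin.last d) → ev _ y A = 0) : A = 0 := by
  have hball : ∀ᶠ y in 𝓝 0, y ∈ evBall (Fin (d + 1)) τ :=
    Metric.ball_mem_nhds _ (evalRadius_pos hτ)
  have hc : Tendsto (fun t : ℝ => EuclideanSpace.single (Fin.last d) t) (𝓝[>] 0)
      (𝓝 (0 : EuclideanSpace ℝ (Fin (d + 1)))) := by
    have h1 : Continuous fun t : ℝ => t • EuclideanSpace.single (Fin.last d) (1 : ℝ) := by fun_prop
    have h2 : (fun t : ℝ => (EuclideanSpace.single (Fin.last d) t :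
        EuclideanSpace ℝ (Fin (d + 1)))) = fun t => t • EuclideanSpace.single (Fin.last d) 1 := by
      funext t
      ext k
      by_cases hk : k = Fin.last d <;> simp [hk]
    rw [h2]
    simpa using (h1.tendsto 0).mono_left nhdsWithin_le_nhds
  obtain ⟨t, ht1, ht2, ht3⟩ := ((hc.eventually h.eventually_nhds).and
    ((hc.eventually hball).and self_mem_nhdsWithin)).exists
  refine eq_zero_of_ev hτ1 ht2 ?_
  have hpos : ∀ᶠ z : EuclideanSpace ℝ (Fin (d + 1)) in
      𝓝 (EuclideanSpace.single (Fin.last d) t), 0 < z (Fin.last d) := by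
    have hcont : Continuous fun z : EuclideanSpace ℝ (Fin (d + 1)) => z (Fin.last d) := by fun_prop
    refine hcont.continuousAt.eventually_const_lt ?_
    simpa using ht3
  filter_upwards [ht1, hpos] with z hz1 hz2 using hz1 hz2

theorem eventually_of_eventually_smul {n : ℕ} {r : ℝ} (hr : r ≠ 0)
    {p : EuclideanSpace ℝ (Fin n) → Prop} (h : ∀ᶠ y in 𝓝 0, p (r • y)) : ∀ᶠ y in 𝓝 0, p y := by
  have hsm : Tendsto (fun y : EuclideanSpace ℝ (Fin n) => r⁻¹ • y) (𝓝 0) (𝓝 0) := by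
    simpa using (continuous_const_smul r⁻¹).tendsto (0 : EuclideanSpace ℝ (Fin n))
  filter_upwards [hsm.eventually h] with y hy
  rwa [smul_smul, mul_inv_cancel₀ hr, one_smul] at hy

end Prelim

/-- If the `1`-jet at `0` of a background function is small, there is exactly one analytic solution
with the same `1`-jet along the boundary. -/
theorem exists_unique_of_boundary_jet {γ : Fin m → ℝ}
    {a : Fin m → Fin (d + 1) → Fin (d + 1) → (Fin m ⊕ Fin m × Fin (d + 1) → ℝ) → ℝ}
    {G : Fin m → (Fin m ⊕ Fin m × Fin (d + 1) → ℝ) → ℝ} (hγ : ∀ j, 0 ≤ γ j)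
    (ha : ∀ j k l, AnalyticAt ℝ (a j k l) 0) (hG : ∀ j, AnalyticAt ℝ (G j) 0)
    (hann : ∀ j, a j (Fin.last d) (Fin.last d) 0 = 0)
    (hGn : ∀ j i, fderiv ℝ (G j) 0 (Pi.single (.inr (i, Fin.last d)) 1) = 0) :
    ∃ κ : ℝ, 0 < κ ∧ ∀ b : Fin m → EuclideanSpace ℝ (Fin (d + 1)) → ℝ,
      (∀ i, AnalyticAt ℝ (b i) 0) →
      (∀ i, ∀ᶠ y in 𝓝 0, partialDeriv (Fin.last d) (partialDeriv (Fin.last d) (b i)) y = 0) →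
      (∀ᶠ y in 𝓝 0, y (Fin.last d) = 0 → ∀ j,
        γ j * partialDeriv (Fin.last d) (b j) y = G j (jetAt b y)) →
      ‖jetAt b 0‖ < κ →
      (∃ u : Fin m → EuclideanSpace ℝ (Fin (d + 1)) → ℝ, (∀ i, AnalyticAt ℝ (u i) 0) ∧
        (∀ᶠ y in 𝓝 0, ∀ j, residual γ a G u y j = 0) ∧
        ∀ᶠ y in 𝓝 0, y (Fin.last d) = 0 → jetAt u y = jetAt b y) ∧
      ∀ u₁ u₂ : Fin m → EuclideanSpace ℝ (Fin (d + 1)) → ℝ,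
        (∀ i, AnalyticAt ℝ (u₁ i) 0) → (∀ i, AnalyticAt ℝ (u₂ i) 0) →
        (∀ᶠ y in 𝓝 0, 0 < y (Fin.last d) → ∀ j, residual γ a G u₁ y j = 0) →
        (∀ᶠ y in 𝓝 0, 0 < y (Fin.last d) → ∀ j, residual γ a G u₂ y j = 0) →
        (∀ᶠ y in 𝓝 0, y (Fin.last d) = 0 → jetAt u₁ y = jetAt b y) →
        (∀ᶠ y in 𝓝 0, y (Fin.last d) = 0 → jetAt u₂ y = jetAt b y) →
        ∀ᶠ y in 𝓝 0, ∀ i, u₁ i y = u₂ i y := by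
  -- the derivative of the fixed point map has norm at most `τ C`, and `τ` is chosen so that `τ C < 1`
  set C : ℝ := ∑ j, ((∑ k, ∑ l, |a j k l 0|) + ∑ z, |fderiv ℝ (G j) 0 (Pi.single z 1)|) with hC
  have hC0 : 0 ≤ C := by positivity
  set τ : ℝ := 1 / (2 * (C + 1)) with hτdef
  have hτ : 0 < τ := by positivity
  have hτ1 : τ ≤ 1 := by
    rw [hτdef, div_le_one (by positivity)]; linarith
  have hq : τ * C < 1 := by
    rw [hτdef, div_mul_eq_mul_div, div_lt_one (by positivity)]; linarith
  obtain ⟨Fa, Fg, ε, hε, hext, hFa, hFa0, hFg, hFg0⟩ := exists_extends (hτ := hτ) hτ1 ha hG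
  set D := systemData hτ1 γ hγ Fa Fg with hD
  obtain ⟨T', hT, hT'⟩ := D.exists_hasStrictFDerivAt_map hτ.le hτ1 hFa hFa0 hFg hFg0 hann hGn
    norm_derivInt_le norm_meanL_le (fun j => norm_fuchsInv_le (hγ j))
  obtain ⟨N, hN, hNu⟩ := hT.exists_unique_fixedPoint_nhds hq hT'
  have hjet : ∀ᶠ x in 𝓝 (0 : FuchsData.Params (Alg d τ hτ) (Fin m) (Fin (d + 1)) ×
      (Fin m → Alg d τ hτ)), ‖D.jet x‖ < ε := by
    refine (D.contDiff_jet.continuous.norm.tendsto 0).eventually_lt_const ?_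
    rw [D.jet_zero, norm_zero]
    exact hε
  obtain ⟨N₁, hN₁, N₂, hN₂, hNN⟩ := mem_nhds_prod_iff.1 (Filter.inter_mem hN hjet)
  -- existence and uniqueness hold on a common product neighbourhood
  have hex := hT.eventually_exists_fixedPoint D.map_zero hq hT' hN₂
  obtain ⟨κ, hκ, hκN⟩ := Metric.mem_nhds_iff.1 (Filter.inter_mem hN₁ hex)
  refine ⟨κ, hκ, fun b hb hbnn hbG hbκ => ?_⟩
  obtain ⟨Z, h, hZ, hh, hrep⟩ := exists_represents (hτ := hτ) hτ1 hb
  -- for small `r` the parameters lie in the neighbourhood on which the fixed point exists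
  have hpar : ∀ᶠ r in 𝓝[>] (0 : ℝ), (Z r, h r, r) ∈ Metric.ball
      (0 : FuchsData.Params (Alg d τ hτ) (Fin m) (Fin (d + 1))) κ := by
    have h1 : Tendsto (fun r : ℝ => (Z r, h r, r)) (𝓝 0)
        (𝓝 (fun z => algebraMap ℝ (Alg d τ hτ) (jetAt b 0 z), 0, 0)) :=
      hZ.prodMk_nhds (hh.prodMk_nhds tendsto_id)
    refine (h1.eventually (Metric.isOpen_ball.mem_nhds ?_)).filter_mono nhdsWithin_le_nhds
    rw [mem_ball_zero_iff, Prod.norm_def, Prod.norm_def]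
    simp only [norm_zero, max_self]
    refine max_lt ((pi_norm_lt_iff hκ).2 fun z => ?_) hκ
    rw [norm_algebraMap']
    exact (norm_le_pi_norm _ z).trans_lt hbκ
  have hrep' := hrep.filter_mono (nhdsWithin_le_nhds (s := Set.Ioi (0 : ℝ)))
  constructor
  · obtain ⟨r, hr1, hr2, hr0⟩ := (hpar.and (hrep'.and self_mem_nhdsWithin)).exists
    have hr0 : 0 < r := hr0
    obtain ⟨hrN₁, U, hU, hUT⟩ := hκN hr1
    have hin : ((Z r, h r, r), U) ∈ N ∩ {x | ‖D.jet x‖ < ε} := hNN ⟨hrN₁, hU⟩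
    set u : Fin m → EuclideanSpace ℝ (Fin (d + 1)) → ℝ := fun i y =>
      b i y + r * ev _ (r⁻¹ • y) (intL hτ1 (intL hτ1 (U i))) with hu
    have hus : ∀ i, ∀ᶠ y in 𝓝 0, u i (r • y)
        = b i (r • y) + r * ev _ y (intL hτ1 (intL hτ1 (U i))) := fun i =>
      .of_forall fun y => by
        simp only [hu]
        rw [smul_smul, inv_mul_cancel₀ hr0.ne', one_smul]
    refine ⟨u, fun i => ?_, ?_, ?_⟩
    · refine (hb i).add (analyticAt_const.mul ?_)
      have h0 : (r⁻¹ • (0 : EuclideanSpace ℝ (Fin (d + 1)))) ∈ evBall (Fin (d + 1)) τ := by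
        rw [smul_zero]; exact Metric.mem_ball_self (evalRadius_pos hτ)
      exact AnalyticAt.comp (f := fun y : EuclideanSpace ℝ (Fin (d + 1)) => r⁻¹ • y)
        (analyticAt_ev_apply hτ1 h0 _)
        ((r⁻¹ • ContinuousLinearMap.id ℝ (EuclideanSpace ℝ (Fin (d + 1)))).analyticAt 0)
    · refine eventually_of_eventually_smul hr0.ne' ?_
      filter_upwards [hr2.eventually_residual hr0 hext hin.2 hb hbnn hbG hus] with y hy j
      have hj := (fuchsInv_eq_iff (hγ j) (U j) _).1 (congrFun hUT j)
      rw [hy j]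
      refine mul_eq_zero_of_right _ ?_
      rw [← map_zero (ev _ y)]
      exact congrArg _ (sub_eq_zero.2 hj)
    · refine eventually_of_eventually_smul hr0.ne' ?_
      have hball : ∀ᶠ y in 𝓝 0, y ∈ evBall (Fin (d + 1)) τ :=
        Metric.ball_mem_nhds _ (evalRadius_pos hτ)
      filter_upwards [hr2.eventually_jet (hτ1 := hτ1) (γ := γ) (hγ := hγ) (Fa := Fa) (Fg := Fg)
        hr0 hb hus, hball] with y hy1 hy2 hy0
      have hy0' : y (Fin.last d) = 0 := by simpa [hr0.ne'] using hy0
      funext z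
      rw [hy1 z, hr2.ev_jet_of_normal_eq_zero hy2 hy0']
  · intro u₁ u₂ hu₁ hu₂ hs₁ hs₂ hb₁ hb₂
    -- every solution yields a fixed point near `0` for all small `r`
    have key : ∀ u : Fin m → EuclideanSpace ℝ (Fin (d + 1)) → ℝ, (∀ i, AnalyticAt ℝ (u i) 0) →
        (∀ᶠ y in 𝓝 0, 0 < y (Fin.last d) → ∀ j, residual γ a G u y j = 0) →
        (∀ᶠ y in 𝓝 0, y (Fin.last d) = 0 → jetAt u y = jetAt b y) →
        ∃ U : ℝ → Fin m → Alg d τ hτ, ∀ᶠ r in 𝓝[>] (0 : ℝ), U r ∈ N₂ ∧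
          U r = D.map ((Z r, h r, r), U r) ∧ ∀ i, ∀ᶠ y in 𝓝 0,
            u i (r • y) = b i (r • y) + r * ev _ y (intL hτ1 (intL hτ1 (U r i))) := by
      intro u hu hs hbu
      obtain ⟨U, hU0, hUe⟩ := exists_secondNormal (hτ := hτ) hτ1 hu
      refine ⟨U, ?_⟩
      filter_upwards [hpar, hrep', (hU0.eventually hN₂).filter_mono nhdsWithin_le_nhds,
        hUe.filter_mono nhdsWithin_le_nhds, self_mem_nhdsWithin] with r hr1 hr2 hr3 hr4 hr0
      have hr0 : 0 < r := hr0
      have hin : ((Z r, h r, r), U r) ∈ N ∩ {x | ‖D.jet x‖ < ε} := hNN ⟨(hκN hr1).1, hr3⟩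
      have hus : ∀ i, ∀ᶠ y in 𝓝 0,
          u i (r • y) = b i (r • y) + r * ev _ y (intL hτ1 (intL hτ1 (U r i))) := fun i =>
        eventually_eq_add_ev_intL_intL hτ1 (hu i) (hb i) (hbnn i)
          (hbu.mono fun y hy h0 => ⟨congrFun (hy h0) (.inl i),
            congrFun (hy h0) (.inr (i, Fin.last d))⟩) (hr4 i)
      refine ⟨hr3, funext fun j => ?_, hus⟩
      refine (fuchsInv_eq_iff (hγ j) _ _).2 (sub_eq_zero.1 (eq_zero_of_ev_normal_pos hτ1 ?_))
      have hsm : Tendsto (fun y : EuclideanSpace ℝ (Fin (d + 1)) => r • y) (𝓝 0) (𝓝 0) := by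
        simpa using (continuous_const_smul r).tendsto (0 : EuclideanSpace ℝ (Fin (d + 1)))
      filter_upwards [hr2.eventually_residual hr0 hext hin.2 hb hbnn hbG hus,
        hsm.eventually hs] with y hy1 hy2 hy0
      have h1 := hy1 j
      rw [hy2 (by simpa using mul_pos hr0 hy0) j] at h1
      exact (mul_eq_zero.1 h1.symm).resolve_left hy0.ne'
    obtain ⟨U₁, hU₁⟩ := key u₁ hu₁ hs₁ hb₁
    obtain ⟨U₂, hU₂⟩ := key u₂ hu₂ hs₂ hb₂
    obtain ⟨r, ⟨h11, h12, h13⟩, ⟨h21, h22, h23⟩, hr1, hr0⟩ :=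
      (hU₁.and (hU₂.and (hpar.and self_mem_nhdsWithin))).exists
    have hr0 : 0 < r := hr0
    have hUU : U₁ r = U₂ r :=
      hNu _ _ _ (hNN ⟨(hκN hr1).1, h11⟩).1 (hNN ⟨(hκN hr1).1, h21⟩).1 h12 h22
    refine eventually_of_eventually_smul hr0.ne' ?_
    filter_upwards [eventually_all.2 h13, eventually_all.2 h23] with y hy1 hy2 i
    rw [hy1, hy2, hUU]

end DegenerateSystem

/-! ### Solutions with prescribed boundary values -/

namespace DegenerateSystem

variable {d m : ℕ}

/-- The vector of all arguments of the nonlinearities, split into `s` and `p`. -/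
noncomputable def argPair (d m : ℕ) : (Fin m ⊕ Fin m × Fin (d + 1) → ℝ) →L[ℝ]
    EuclideanSpace ℝ (Fin m) × (Fin m → Fin (d + 1) → ℝ) :=
  ((PiLp.continuousLinearEquiv 2 ℝ fun _ : Fin m => ℝ).symm.toContinuousLinearMap.comp
    (ContinuousLinearMap.pi fun i => ContinuousLinearMap.proj (Sum.inl i))).prod
    (ContinuousLinearMap.pi fun i => ContinuousLinearMap.pi fun k =>
      ContinuousLinearMap.proj (Sum.inr (i, k)))

theorem argPair_single_inr (i : Fin m) (k : Fin (d + 1)) :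
    argPair d m (Pi.single (.inr (i, k)) 1) = (0, Pi.single i (Pi.single k 1)) := by
  refine Prod.ext ?_ ?_
  · ext j
    simp [argPair]
  · funext j l
    by_cases hj : j = i
    · by_cases hl : l = k <;> simp [argPair, hj, hl]
    · simp [argPair, hj]

theorem systemAt_iff_residual {γ : Fin m → ℝ}
    {A : Fin m → Fin (d + 1) → Fin (d + 1) → (Fin m → Fin (d + 1) → ℝ) → ℝ}
    {g : Fin m → EuclideanSpace ℝ (Fin m) × (Fin m → Fin (d + 1) → ℝ) → ℝ}
    {v : EuclideanSpace ℝ (Fin (d + 1)) → EuclideanSpace ℝ (Fin m)}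
    {y : EuclideanSpace ℝ (Fin (d + 1))} :
    SystemAt γ A g v y ↔ ∀ j, residual γ (fun j k l z => A j k l (argPair d m z).2)
      (fun j z => g j (argPair d m z)) (fun i y => v y i) y j = 0 :=
  forall_congr' fun _ => sub_eq_zero.symm

theorem analyticAt_jetAt {u : Fin m → EuclideanSpace ℝ (Fin (d + 1)) → ℝ}
    (hu : ∀ i, AnalyticAt ℝ (u i) 0) : AnalyticAt ℝ (jetAt u) 0 := by
  refine AnalyticAt.pi fun z => ?_
  rcases z with i | ik
  · exact hu i
  · exact (hu ik.1).partialDeriv ik.2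

theorem analyticAt_residual {γ : Fin m → ℝ}
    {a : Fin m → Fin (d + 1) → Fin (d + 1) → (Fin m ⊕ Fin m × Fin (d + 1) → ℝ) → ℝ}
    {G : Fin m → (Fin m ⊕ Fin m × Fin (d + 1) → ℝ) → ℝ}
    {u : Fin m → EuclideanSpace ℝ (Fin (d + 1)) → ℝ} (hu : ∀ i, AnalyticAt ℝ (u i) 0)
    (ha : ∀ j k l, AnalyticAt ℝ (a j k l) (jetAt u 0))
    (hG : ∀ j, AnalyticAt ℝ (G j) (jetAt u 0)) (j : Fin m) :
    AnalyticAt ℝ (fun y => residual γ a G u y j) 0 := by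
  have hn : AnalyticAt ℝ (fun y : EuclideanSpace ℝ (Fin (d + 1)) => y (Fin.last d)) 0 :=
    (EuclideanSpace.proj (Fin.last d) : EuclideanSpace ℝ (Fin (d + 1)) →L[ℝ] ℝ).analyticAt 0
  have h2 : ∀ k l, AnalyticAt ℝ (partialDeriv k (partialDeriv l (u j))) 0 := fun k l =>
    ((hu j).partialDeriv l).partialDeriv k
  have hs : AnalyticAt ℝ (fun y => ∑ k, ∑ l,
      a j k l (jetAt u y) * partialDeriv k (partialDeriv l (u j)) y) 0 :=
    Finset.analyticAt_fun_sum _ fun k _ => Finset.analyticAt_fun_sum _ fun l _ =>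
      ((ha j k l).comp (analyticAt_jetAt hu)).mul (h2 k l)
  exact ((hn.mul (h2 _ _)).add (analyticAt_const.mul ((hu j).partialDeriv _))).sub
    ((hn.mul hs).add ((hG j).comp (analyticAt_jetAt hu)))

/-- An analytic function which vanishes for `y_n > 0` vanishes for `y_n = 0`. -/
theorem eventually_eq_zero_of_normal_pos {f : EuclideanSpace ℝ (Fin (d + 1)) → ℝ}
    (hf : AnalyticAt ℝ f 0) (h : ∀ᶠ y in 𝓝 0, 0 < y (Fin.last d) → f y = 0) :
    ∀ᶠ y in 𝓝 0, y (Fin.last d) = 0 → f y = 0 := by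
  filter_upwards [hf.eventually_analyticAt, h.eventually_nhds] with y hy1 hy2 hy0
  have hc : Tendsto (fun t : ℝ => y + t • EuclideanSpace.single (Fin.last d) (1 : ℝ)) (𝓝[>] 0)
      (𝓝 y) := by
    have h1 : Continuous fun t : ℝ => y + t • EuclideanSpace.single (Fin.last d) (1 : ℝ) := by
      fun_prop
    simpa using (h1.tendsto 0).mono_left nhdsWithin_le_nhds
  refine tendsto_nhds_unique (hy1.continuousAt.tendsto.comp hc) ?_
  refine tendsto_const_nhds.congr' ?_
  filter_upwards [hc.eventually hy2, self_mem_nhdsWithin] with t ht ht0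
  exact (ht (by simpa [hy0] using ht0)).symm

end DegenerateSystem

open DegenerateSystem in
theorem mainTheorem3 (d m : ℕ) (γ : Fin m → ℝ)
    (A : Fin m → Fin (d + 1) → Fin (d + 1) → (Fin m → Fin (d + 1) → ℝ) → ℝ)
    (g : Fin m → EuclideanSpace ℝ (Fin m) × (Fin m → Fin (d + 1) → ℝ) → ℝ)
    (hγ : ∀ j, 1 < γ j)
    (hA : ∀ j k l, AnalyticAt ℝ (A j k l) 0)
    (hg : ∀ j, AnalyticAt ℝ (g j) (0, 0))
    (hAnn : ∀ j, A j (Fin.last d) (Fin.last d) 0 = 0)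
    (hg0 : ∀ j, g j (0, 0) = 0)
    (hgn : ∀ j i, fderiv ℝ (g j) (0, 0) (0, Pi.single i (Pi.single (Fin.last d) 1)) = 0) :
    ∃ δ₀ : ℝ, 0 < δ₀ ∧ ∀ δ : ℝ, 0 < δ → δ ≤ δ₀ → ∃ ε₀ : ℝ, 0 < ε₀ ∧
      ∀ v₀ : EuclideanSpace ℝ (Fin d) → EuclideanSpace ℝ (Fin m),
        AnalyticAt ℝ v₀ 0 → ‖v₀ 0‖ ≤ ε₀ → ‖fderiv ℝ v₀ 0‖ ≤ ε₀ →
        ∃ v : EuclideanSpace ℝ (Fin (d + 1)) → EuclideanSpace ℝ (Fin m),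
          AnalyticAt ℝ v 0 ∧
          (∀ᶠ y in 𝓝 0, DegenerateSystem.SystemAt γ A g v y) ∧
          (∀ᶠ y' in 𝓝 0, v (DegenerateSystem.boundaryPoint y') = v₀ y') ∧
          ‖DegenerateSystem.normalDeriv v 0‖ ≤ δ ∧
          ∀ w : EuclideanSpace ℝ (Fin (d + 1)) → EuclideanSpace ℝ (Fin m),
            AnalyticAt ℝ w 0 →
            (∀ᶠ y in 𝓝[{y | 0 < y (Fin.last d)}] 0, DegenerateSystem.SystemAt γ A g w y) →
            (∀ᶠ y' in 𝓝 0, w (DegenerateSystem.boundaryPoint y') = v₀ y') →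
            ‖DegenerateSystem.normalDeriv w 0‖ ≤ δ₀ →
            w =ᶠ[𝓝 0] v := by
  set a : Fin m → Fin (d + 1) → Fin (d + 1) → (Fin m ⊕ Fin m × Fin (d + 1) → ℝ) → ℝ :=
    fun j k l z => A j k l (argPair d m z).2 with ha_def
  set G : Fin m → (Fin m ⊕ Fin m × Fin (d + 1) → ℝ) → ℝ := fun j z => g j (argPair d m z)
    with hG_def
  have hγ0 : ∀ j, 0 < γ j := fun j => one_pos.trans (hγ j)
  have h00 : argPair d m 0 = (0, 0) := map_zero _
  have ha : ∀ j k l, AnalyticAt ℝ (a j k l) 0 := fun j k l =>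
    AnalyticAt.comp (f := fun z => (argPair d m z).2) (x := 0)
      (by rw [h00]; exact hA j k l)
      (((ContinuousLinearMap.snd ℝ _ _).comp (argPair d m)).analyticAt 0)
  have hG : ∀ j, AnalyticAt ℝ (G j) 0 := fun j =>
    AnalyticAt.comp (f := argPair d m) (x := 0) (by rw [h00]; exact hg j)
      ((argPair d m).analyticAt 0)
  have hG0 : ∀ j, G j 0 = 0 := fun j => by simp only [hG_def, h00, hg0]
  have hann : ∀ j, a j (Fin.last d) (Fin.last d) 0 = 0 := fun j => by
    simp only [ha_def, h00, hAnn]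
  have hGn : ∀ j i, fderiv ℝ (G j) 0 (Pi.single (.inr (i, Fin.last d)) 1) = 0 := fun j i => by
    have h1 : HasFDerivAt (g j) (fderiv ℝ (g j) (0, 0)) (argPair d m 0) := by
      rw [h00]; exact (hg j).differentiableAt.hasFDerivAt
    have h2 := (h1.comp 0 (argPair d m).hasFDerivAt).fderiv
    refine (DFunLike.congr_fun h2 _).trans ?_
    rw [ContinuousLinearMap.comp_apply, argPair_single_inr, hgn]
  obtain ⟨Φ, hΦ, hΦ0, hΦr, hΦl⟩ := exists_boundaryMap_inverse hγ0 hG hG0 hGn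
  obtain ⟨κ, hκ, hmain⟩ := exists_unique_of_boundary_jet (fun j => (hγ0 j).le) ha hG hann hGn
  -- on the ball of radius `η` the boundary equation determines the normal derivative
  obtain ⟨η, hη, hηb⟩ := Metric.eventually_nhds_iff_ball.1 (hΦl.eventually_nhds.and
    ((eventually_all.2 fun j => eventually_all.2 fun k => eventually_all.2 fun l =>
      (ha j k l).eventually_analyticAt).and
      (eventually_all.2 fun j => (hG j).eventually_analyticAt)))
  refine ⟨η / 2, half_pos hη, fun δ hδ _ => ?_⟩
  have hsmall : ∀ᶠ z in 𝓝 (0 : Fin m ⊕ Fin m × Fin (d + 1) → ℝ), ‖Φ z‖ < κ ∧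
      ‖(WithLp.toLp 2 fun i => Φ z (.inr (i, Fin.last d)) : EuclideanSpace ℝ (Fin m))‖ < δ := by
    have hc := hΦ.continuousAt.tendsto
    rw [hΦ0] at hc
    have h1 : Continuous fun z : Fin m ⊕ Fin m × Fin (d + 1) → ℝ =>
        (WithLp.toLp 2 fun i => z (.inr (i, Fin.last d)) : EuclideanSpace ℝ (Fin m)) :=
      (PiLp.continuous_toLp 2 _).comp (by fun_prop)
    refine (hc.norm.eventually_lt_const (by rwa [norm_zero])).and
      (((h1.tendsto 0).comp hc).norm.eventually_lt_const ?_)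
    have h2 : (WithLp.toLp 2 fun i : Fin m => (0 : Fin m ⊕ Fin m × Fin (d + 1) → ℝ)
      (.inr (i, Fin.last d)) : EuclideanSpace ℝ (Fin m)) = 0 := by ext; simp
    rwa [h2, norm_zero]
  obtain ⟨ε₁, hε₁, hε₁b⟩ := Metric.eventually_nhds_iff_ball.1 (hΦ.eventually_analyticAt.and
    (hΦr.eventually_nhds.and hsmall))
  refine ⟨min (ε₁ / 2) (η / 2), lt_min (half_pos hε₁) (half_pos hη), fun v₀ hv₀ h0 h1 => ?_⟩
  have hdata := norm_boundaryData_le h0 h1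
  obtain ⟨hΦv, hΦrv, hκv, hδv⟩ := hε₁b (boundaryData v₀ 0) (mem_ball_zero_iff.2
    ((hdata.trans (min_le_left _ _)).trans_lt (half_lt_self hε₁)))
  have hjb := jetAt_background (γ := γ) (G := G) hΦv hv₀ hΦrv
  have hjb0 : jetAt (background Φ v₀) 0 = Φ (boundaryData v₀ 0) := by
    have := hjb.self_of_nhds rfl
    rwa [map_zero] at this
  obtain ⟨⟨u, hu, hus, hub⟩, huniq⟩ := hmain (background Φ v₀) (analyticAt_background hΦv hv₀)
    (partialDeriv_last_last_background hΦv hv₀) (background_boundary_equation hΦv hv₀ hΦrv)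
    (by rwa [hjb0])
  refine ⟨fun y => WithLp.toLp 2 fun i => u i y, ?_, ?_, ?_, ?_, fun w hw hws hwb hwn => ?_⟩
  · exact ((PiLp.continuousLinearEquiv 2 ℝ fun _ : Fin m => ℝ).symm.toContinuousLinearMap.analyticAt
      _).comp (AnalyticAt.pi hu)
  · filter_upwards [hus] with y hy
    exact systemAt_iff_residual.2 hy
  · filter_upwards [tendsto_boundaryPoint.eventually hub] with x hx
    ext i
    have := congrFun (hx (boundaryPoint_last x)) (.inl i)
    exact this.trans (background_boundary i x)
  · have : normalDeriv (fun y => (WithLp.toLp 2 fun i => u i y : EuclideanSpace ℝ (Fin m))) 0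
        = WithLp.toLp 2 fun i => Φ (boundaryData v₀ 0) (.inr (i, Fin.last d)) := by
      rw [← hjb0, ← hub.self_of_nhds rfl]
      rfl
    rw [this]
    exact hδv.le
  · have hwi : ∀ i, AnalyticAt ℝ (fun y => w y i) 0 := fun i =>
      ((EuclideanSpace.proj (𝕜 := ℝ) i).analyticAt _).comp hw
    have hwbi : ∀ i, ∀ᶠ x in 𝓝 0, w (boundaryPoint x) i = v₀ x i := fun i =>
      hwb.mono fun x hx => by rw [hx]
    have hws' : ∀ᶠ y in 𝓝 0, 0 < y (Fin.last d) → ∀ j,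
        residual γ a G (fun i y => w y i) y j = 0 :=
      (eventually_nhdsWithin_iff.1 hws).mono fun y hy hpos => systemAt_iff_residual.1 (hy hpos)
    -- the jet of `w` at `0` lies in the ball of radius `η`
    have hw0 : ‖jetAt (fun i y => w y i) 0‖ < η := by
      -- for `γ = 0`, `G = 0` the boundary equation is void, and only the trace of `w` is used
      have hb0 := (boundaryMap_jetAt (γ := fun _ => 0) (G := fun _ _ => 0) hwi hv₀
        hwbi).self_of_nhds rfl fun j => by simp
      rw [map_zero] at hb0
      refine lt_of_le_of_lt ((pi_norm_le_iff_of_nonneg (half_pos hη).le).2 fun s => ?_)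
        (half_lt_self hη)
      have hs := congrFun hb0 s
      have hbs := ((norm_le_pi_norm (boundaryData v₀ 0) s).trans hdata).trans (min_le_right _ _)
      rcases s with i | ⟨i, k⟩
      · simp only [boundaryMap, Sum.elim_inl] at hs
        rwa [hs]
      · by_cases hk : k = Fin.last d
        · subst hk
          exact (PiLp.norm_apply_le (normalDeriv w 0) i).trans hwn
        · simp only [boundaryMap, Sum.elim_inr, if_neg hk] at hs
          rwa [hs]
    obtain ⟨hΦlw, haw, hGw⟩ := hηb _ (mem_ball_zero_iff.2 hw0)
    -- by continuity the system holds up to the boundary, where it reduces to the boundary equation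
    have hres : ∀ᶠ y in 𝓝 0, ∀ j, y (Fin.last d) = 0 →
        residual γ a G (fun i y => w y i) y j = 0 := eventually_all.2 fun j =>
      eventually_eq_zero_of_normal_pos (analyticAt_residual hwi haw hGw j)
        (hws'.mono fun y hy hpos => hy hpos j)
    have hwj : ∀ᶠ y in 𝓝 0, y (Fin.last d) = 0 →
        jetAt (fun i y => w y i) y = jetAt (background Φ v₀) y := by
      filter_upwards [hres, boundaryMap_jetAt (γ := γ) (G := G) hwi hv₀ hwbi, hjb,
        (analyticAt_jetAt hwi).continuousAt.eventually hΦlw] with y hy1 hy2 hy3 hy4 hy0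
      have h2 := hy2 hy0 fun j => by
        have := hy1 j hy0
        rw [DegenerateSystem.residual, hy0, zero_mul, zero_mul, zero_add, zero_add] at this
        exact sub_eq_zero.1 this
      rw [hy3 hy0, ← h2, hy4]
    filter_upwards [huniq _ u hwi hu hws' (hus.mono fun y hy _ => hy) hwj hub] with y hy
    ext i
    exact hy i
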